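/- Let $0<\alpha<1$, $d>0$ and $M$ be real numbers, let $$\mathcal T_\alpha=\{z\in\mathbb C\setminus\{0\} : |\arg z|<\arctan\alpha \text{ or } |\pi-\arg z|<\arctan\alpha\},\qquad \mathcal D_d=\{z\in\mathbb C : |\operatorname{Im} z|<d\},$$ where the argument is understood modulo $2\pi$ (so $\mathcal T_\alpha$ is the open double sector $|\operatorname{Im} z|<\alpha|\operatorname{Re} z|$), and let $f$ be a complex function satisfying the following two assumptions. (i) $f$ is analytic on $\mathcal T_\alpha$, $|f(z)|\le M$ for all $z\in\mathcal T_\alpha$, and $\lim_{R\to\infty}\sup_{-\alpha<\beta<\alpha}|f(\pm R+\mathrm i\beta R)|=0$. (ii) $f$ is analytic on $\mathcal D_d$, $|f(z)|\le M$ for all $z\in\mathcal D_d$, and $f$ is square integrable on $\mathbb R$. Let $\omega_d,\omega_u$ be real numbers with $0<\omega_d<\omega_u$ and $\omega_d/\omega_u\le\min\{\alpha,1/2\}$, let $N$ be an integer with $$N\ge\frac{2d(\omega_d+\omega_u)\omega_u^2}{\pi\,\omega_d^2},$$ and put $$h=\sqrt{\frac{2\pi d(\omega_d+\omega_u)}{\omega_d^2N}},\qquad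 p=\sqrt{\frac{Nh}{\omega_d}},\qquad q=\sqrt{\frac{\omega_dNh}{4}}.$$ Let $w(x;p,q)=\frac12\operatorname{erfc}\left(\frac xp-q\right)$ with $\operatorname{erfc}(x)=\frac{2}{\sqrt\pi}\int_x^\infty e^{-t^2}\,dt$, and $$F_w^{(N,h)}(\omega)=h\sum_{n=-N-1}^{N}w(|nh|;p,q)\,f(nh)\,e^{-\mathrm i\omega nh}.$$ Then for every real $\omega$ with $\omega_d\le|\omega|\le\omega_u$ the improper integral $F(\omega)=\int_{-\infty}^\infty f(x)e^{-\mathrm i\omega x}\,dx$ converges (with both limits of integration taken independently), and $$\left|F(\omega)-F_w^{(N,h)}(\omega)\right|\le C(N)\exp\left(-\sqrt{\frac{\pi d\,\omega_d^2N}{2(\omega_d+\omega_u)}}\right),$$ where $C(N)=C_1(N)+C_2(N)+C_3(N)$ and $$C_1(N)=M\sqrt{\omega_u^2+\omega_d^2}\left\{\frac{\sqrt\pi}{\sqrt{\omega_u^2-\omega_d^2}}\left(\frac{2\pi d(\omega_d+\omega_u)N}{\omega_d^4}\right)^{1/4}+\frac{2}{\omega_d^2}\right\},$$ $$C_2(N)=\frac{2M}{1-e^{-2d\omega_u}}\left\{\frac{\sqrt\pi}{2}\left(\frac{2\pi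 d(\omega_d+\omega_u)N}{\omega_d^4}\right)^{1/4}+\sqrt{\frac{\pi d(\omega_d+\omega_u)N}{2\omega_d^2}}\right\}e^{d\omega_d/4},$$ $$C_3(N)=\frac{\sqrt\pi\,M}{2}\left(\frac{2\pi d(\omega_d+\omega_u)N}{\omega_d^4}\right)^{1/4}.$$ -/

import Mathlib

open MeasureTheory Filter Topology Complex

noncomputable section

namespace EulerFT

/-- The complementary error function `erfc x = (2/√π) ∫_x^∞ exp(-t²) dt`. -/
def erfc (x : ℝ) : ℝ :=
  2 / Real.sqrt Real.pi * ∫ t in Set.Ioi x, Real.exp (-t ^ 2)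

/-- The weight function `w(x; p, q) = erfc(x/p - q) / 2` of the continuous Euler transform. -/
def weight (p q x : ℝ) : ℝ :=
  1 / 2 * erfc (x / p - q)

/-- The open double sector `𝒯_α` around the real axis, without its vertex. The condition
`|π - arg z| < arctan α` (with the argument taken modulo `2π`) reads `|arg (-z)| < arctan α`. The
vertex is excluded explicitly because `arg 0 = 0` here. -/
def doubleSector (α : ℝ) : Set ℂ :=
  {z : ℂ | z ≠ 0 ∧ (|arg z| < Real.arctan α ∨ |arg (-z)| < Real.arctan α)}

/-- The strip `𝒟_d`. -/
def strip (d : ℝ) : Set ℂ :=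
  {z : ℂ | |z.im| < d}

/-- `f` is analytic on the double sector, bounded by `M` there, and `f (±R + iβR) → 0` as
`R → ∞`, uniformly in the slopes `β` with `|β| < α`. -/
structure SectorAssumption (f : ℂ → ℂ) (α M : ℝ) : Prop where
  analytic : AnalyticOnNhd ℂ f (doubleSector α)
  bound : ∀ z ∈ doubleSector α, ‖f z‖ ≤ M
  decay_right : TendstoUniformlyOn
    (fun (R β : ℝ) => f ((R : ℂ) + I * β * R)) (fun _ => 0) atTop (Set.Ioo (-α) α)
  decay_left : TendstoUniformlyOn
    (fun (R β : ℝ) => f (-(R : ℂ) + I * β * R)) (fun _ => 0) atTop (Set.Ioo (-α) α)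

/-- `f` is analytic on the strip, bounded by `M` there, and square integrable on the real line. -/
structure StripAssumption (f : ℂ → ℂ) (d M : ℝ) : Prop where
  analytic : AnalyticOnNhd ℂ f (strip d)
  bound : ∀ z ∈ strip d, ‖f z‖ ≤ M
  memLp_two : MemLp (fun x : ℝ => f x) 2 volume

/-- The improper integral `∫_{-∞}^{∞} f(x) e^{-iωx} dx`, both limits being taken independently,
converges to `L`. (The function `f` need not be absolutely integrable.) -/
def HasFourierTransformAt (f : ℂ → ℂ) (ω : ℝ) (L : ℂ) : Prop :=
  Tendsto (fun R : ℝ × ℝ => ∫ x in R.1..R.2, f (x : ℂ) * exp (-I * ω * x))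
    (atBot ×ˢ atTop) (𝓝 L)

/-- The truncated weighted trapezoidal sum
`F_w^{(N,h)}(ω) = h ∑_{n=-N-1}^{N} w(|nh|; p, q) f(nh) e^{-iωnh}`. -/
def trapezoidalSum (f : ℂ → ℂ) (p q h : ℝ) (N : ℕ) (ω : ℝ) : ℂ :=
  h * ∑ n ∈ Finset.Icc (-(N : ℤ) - 1) (N : ℤ),
    (weight p q |(n : ℝ) * h| : ℂ) * f ((n : ℂ) * h) * exp (-I * ω * (n * h))

/-- The constant `C₁(N)`. -/
def const₁ (d ωd ωu M : ℝ) (N : ℕ) : ℝ :=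
  M * Real.sqrt (ωu ^ 2 + ωd ^ 2) *
    (Real.sqrt Real.pi / Real.sqrt (ωu ^ 2 - ωd ^ 2) *
        (2 * Real.pi * d * (ωd + ωu) * N / ωd ^ 4) ^ (1 / 4 : ℝ)
      + 2 / ωd ^ 2)

/-- The constant `C₂(N)`. -/
def const₂ (d ωd ωu M : ℝ) (N : ℕ) : ℝ :=
  2 * M / (1 - Real.exp (-2 * d * ωu)) *
    (Real.sqrt Real.pi / 2 * (2 * Real.pi * d * (ωd + ωu) * N / ωd ^ 4) ^ (1 / 4 : ℝ)
      + Real.sqrt (Real.pi * d * (ωd + ωu) * N / (2 * ωd ^ 2))) *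
    Real.exp (d * ωd / 4)

/-- The constant `C₃(N)`. -/
def const₃ (d ωd ωu M : ℝ) (N : ℕ) : ℝ :=
  Real.sqrt Real.pi * M / 2 * (2 * Real.pi * d * (ωd + ωu) * N / ωd ^ 4) ^ (1 / 4 : ℝ)

end EulerFT

end

noncomputable section

namespace EulerFT

/-! Split `F` into the integrals of `(1 - w(|x|)) f e^{-iωx}` and of `w(|x|) f e^{-iωx}`. The first
need not converge absolutely. On each half line its contour is turned to a ray of slope `±β`, on the
side where `e^{-iωz}` decays. The bound `|erfc z| ≤ |exp(-z²)|` for `Re z ≥ 0` (`norm_cerfc_le`) and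
a completed square then give convergence and the rate `exp(-2βq²/(1+β))`
(`tendsto_integral_rotated`, `tendsto_integral_half_line`).

The second integral converges absolutely, and the sum approximates it. Since `w(|x|)` has a corner
at `0`, it is replaced by the entire even weight `W = smoothWeight`; the difference is `erfc(|x|/p +
q)/2`, of size `exp(-q²)`. Because `N h = 2pq`, the weight lost by truncation is this same tail
shifted by `N` nodes (`norm_trapezoidalSum_sub_le`).

For `W f e^{-iωz}` on the strip, the integrand is periodized. The trapezoidal error is the sum of
the nonzero Fourier coefficients of the periodization (`norm_sub_integral_le`,
`norm_trapezoid_sub_integral_le`), with rate `exp(|ω|·d - 2πd/h)`. The lower bound on `N` says `h ωu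
≤ π`, so this is at most `exp(-πd/h)`.

The slope `β = ωd/ωu` and the choice of `h` make the rotation exponent equal to `πd/h`, the exponent
of the theorem; `q²` is no smaller. -/

/-! ### The complementary error function on the complex plane. -/

theorem exists_primitive_exp_neg_sq :
    ∃ E : ℂ → ℂ, E 0 = 0 ∧ ∀ z, HasDerivAt E (exp (-z ^ 2)) z := by
  have hd : Differentiable ℂ fun z : ℂ => exp (-z ^ 2) := by fun_prop
  obtain ⟨E, h0, hE⟩ := hd.isExactOn_univ.with_val_at 0 0
  exact ⟨E, h0, fun z => hE z (Set.mem_univ z)⟩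

/-- The primitive of `exp (-z ^ 2)` that vanishes at the origin. -/
def gaussPrim : ℂ → ℂ := exists_primitive_exp_neg_sq.choose

theorem gaussPrim_zero : gaussPrim 0 = 0 := exists_primitive_exp_neg_sq.choose_spec.1

theorem hasDerivAt_gaussPrim (z : ℂ) : HasDerivAt gaussPrim (exp (-z ^ 2)) z :=
  exists_primitive_exp_neg_sq.choose_spec.2 z

theorem differentiable_gaussPrim : Differentiable ℂ gaussPrim :=
  fun z => (hasDerivAt_gaussPrim z).differentiableAt

theorem gaussPrim_add_sub (z : ℂ) (a b : ℝ) :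
    gaussPrim (z + b) - gaussPrim (z + a) = ∫ v in a..b, exp (-(z + v) ^ 2) := by
  symm
  refine intervalIntegral.integral_eq_sub_of_hasDerivAt (f := fun v : ℝ => gaussPrim (z + v))
    (fun x _ => ?_) (by apply Continuous.intervalIntegrable; fun_prop)
  have h1 : HasDerivAt (fun v : ℂ => gaussPrim (z + v)) (exp (-(z + x) ^ 2)) (x : ℂ) :=
    HasDerivAt.comp_const_add z (x : ℂ) (hasDerivAt_gaussPrim (z + x))
  exact h1.comp_ofReal

theorem gaussPrim_neg (z : ℂ) : gaussPrim (-z) = -gaussPrim z := by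
  have h : ∀ z, HasDerivAt (fun z => gaussPrim (-z) + gaussPrim z) 0 z := fun z => by
    have h1 := ((hasDerivAt_gaussPrim (-z)).comp z (hasDerivAt_neg z)).add (hasDerivAt_gaussPrim z)
    exact h1.congr_deriv (by simp)
  have h2 := is_const_of_deriv_eq_zero (fun z => (h z).differentiableAt) (fun z => (h z).deriv) z 0
  simp [gaussPrim_zero] at h2
  linear_combination h2

theorem gaussPrim_ofReal (x : ℝ) :
    gaussPrim x = ((∫ t in (0 : ℝ)..x, Real.exp (-t ^ 2) : ℝ) : ℂ) := by
  have h := gaussPrim_add_sub 0 0 x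
  simp only [zero_add, ofReal_zero, gaussPrim_zero, sub_zero] at h
  rw [h, ← intervalIntegral.integral_ofReal]
  simp

theorem integrable_exp_neg_sq : Integrable fun t : ℝ => Real.exp (-t ^ 2) := by
  simpa using integrable_exp_neg_mul_sq one_pos

theorem integral_Ioi_zero_exp_neg_sq :
    ∫ t in Set.Ioi (0 : ℝ), Real.exp (-t ^ 2) = Real.sqrt Real.pi / 2 := by
  simpa using integral_gaussian_Ioi 1

theorem erfc_eq (x : ℝ) :
    erfc x = 1 - 2 / Real.sqrt Real.pi * ∫ t in (0 : ℝ)..x, Real.exp (-t ^ 2) := by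
  have h := intervalIntegral.integral_Ioi_sub_Ioi' (a := (0 : ℝ)) (b := x)
    (integrable_exp_neg_sq.integrableOn) (integrable_exp_neg_sq.integrableOn)
  rw [← h, integral_Ioi_zero_exp_neg_sq, erfc]
  have : Real.sqrt Real.pi ≠ 0 := by positivity
  field_simp
  ring

/-- The entire extension of the complementary error function. -/
def cerfc (z : ℂ) : ℂ := 1 - 2 / (Real.sqrt Real.pi : ℂ) * gaussPrim z

theorem cerfc_ofReal (x : ℝ) : cerfc x = erfc x := by
  rw [cerfc, gaussPrim_ofReal, erfc_eq]; push_cast; rfl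

theorem differentiable_cerfc : Differentiable ℂ cerfc := by
  unfold cerfc
  exact (differentiable_const _).sub (differentiable_gaussPrim.const_mul _)

theorem cerfc_neg (z : ℂ) : cerfc (-z) = 2 - cerfc z := by
  simp only [cerfc, gaussPrim_neg]; ring

theorem norm_exp_neg_sq (z : ℂ) : ‖exp (-z ^ 2)‖ = Real.exp (z.im ^ 2 - z.re ^ 2) := by
  rw [norm_exp]; congr 1; simp [pow_two]

theorem hasDerivAt_erfc (x : ℝ) :
    HasDerivAt erfc (-(2 / Real.sqrt Real.pi * Real.exp (-x ^ 2))) x := by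
  have h : erfc = fun x => 1 - 2 / Real.sqrt Real.pi * ∫ t in (0 : ℝ)..x, Real.exp (-t ^ 2) :=
    funext erfc_eq
  rw [h]
  have hc : Continuous fun t : ℝ => Real.exp (-t ^ 2) := by fun_prop
  exact ((hc.integral_hasStrictDerivAt 0 x).hasDerivAt.const_mul _).const_sub 1

theorem continuous_erfc : Continuous erfc :=
  continuous_iff_continuousAt.2 fun x => (hasDerivAt_erfc x).continuousAt

theorem erfc_nonneg (x : ℝ) : 0 ≤ erfc x :=
  mul_nonneg (by positivity) (integral_nonneg fun t => (Real.exp_pos _).le)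

theorem erfc_neg (x : ℝ) : erfc (-x) = 2 - erfc x := by
  have h := cerfc_neg x
  rw [← ofReal_neg, cerfc_ofReal, cerfc_ofReal] at h
  exact_mod_cast h

theorem erfc_antitone : Antitone erfc :=
  antitone_of_deriv_nonpos (fun x => (hasDerivAt_erfc x).differentiableAt) fun x => by
    rw [(hasDerivAt_erfc x).deriv]
    exact neg_nonpos.2 (by positivity)

theorem one_sub_erfc_le {q : ℝ} (hq : 0 ≤ q) : 1 - erfc q ≤ 2 * q / Real.sqrt Real.pi := by
  rw [erfc_eq]
  have h : ∫ t in (0 : ℝ)..q, Real.exp (-t ^ 2) ≤ ∫ t in (0 : ℝ)..q, (1 : ℝ) := by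
    refine intervalIntegral.integral_mono_on hq
      (by apply Continuous.intervalIntegrable; fun_prop) (by simp) fun t _ => ?_
    exact Real.exp_le_one_iff.2 (by nlinarith)
  simp only [intervalIntegral.integral_const, sub_zero, smul_eq_mul, mul_one] at h
  calc _ = 2 / Real.sqrt Real.pi * ∫ t in (0 : ℝ)..q, Real.exp (-t ^ 2) := by ring
    _ ≤ 2 / Real.sqrt Real.pi * q := by gcongr
    _ = _ := by ring

/-- On a horizontal line the limit is the one on the real axis: the vertical segment joining the two
lines has fixed length, and the Gaussian on it tends to `0`. -/
theorem tendsto_gaussPrim_add (z : ℂ) :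
    Tendsto (fun T : ℝ => gaussPrim (z + T)) atTop (𝓝 ((Real.sqrt Real.pi / 2 : ℝ) : ℂ)) := by
  have h1 : Tendsto (fun T : ℝ => gaussPrim ((z.re + T : ℝ) : ℂ)) atTop
      (𝓝 ((Real.sqrt Real.pi / 2 : ℝ) : ℂ)) := by
    have h2 : Tendsto (fun x : ℝ => ∫ t in (0 : ℝ)..x, Real.exp (-t ^ 2)) atTop
        (𝓝 (Real.sqrt Real.pi / 2)) := by
      rw [← integral_Ioi_zero_exp_neg_sq]
      exact intervalIntegral_tendsto_integral_Ioi 0 integrable_exp_neg_sq.integrableOn tendsto_id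
    simp only [gaussPrim_ofReal]
    exact ((continuous_ofReal.tendsto _).comp
      (h2.comp (tendsto_atTop_add_const_left atTop z.re tendsto_id)))
  have h3 : Tendsto (fun T : ℝ => gaussPrim (z + T) - gaussPrim ((z.re + T : ℝ) : ℂ)) atTop
      (𝓝 0) := by
    have hb : ∀ T : ℝ, ‖gaussPrim (z + T) - gaussPrim ((z.re + T : ℝ) : ℂ)‖ ≤
        Real.exp (z.im ^ 2) * |z.im| * Real.exp (-(z.re + T) ^ 2) := fun T => by
      have := Convex.norm_image_sub_le_of_norm_hasDerivWithin_le (f := gaussPrim)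
        (f' := fun z => exp (-z ^ 2)) (s := segment ℝ ((z.re + T : ℝ) : ℂ) (z + T))
        (C := Real.exp (z.im ^ 2 - (z.re + T) ^ 2)) (x := ((z.re + T : ℝ) : ℂ)) (y := z + T)
        (fun w _ => (hasDerivAt_gaussPrim w).hasDerivWithinAt) ?_ (convex_segment _ _)
        (left_mem_segment _ _ _) (right_mem_segment _ _ _)
      · have hz : z + T - ((z.re + T : ℝ) : ℂ) = z.im * I := by
          apply Complex.ext <;> simp
        rw [hz, norm_mul, norm_I, mul_one, norm_real, Real.norm_eq_abs] at this
        refine this.trans (le_of_eq ?_)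
        rw [sub_eq_add_neg, Real.exp_add]; ring
      · rintro w ⟨a, b, ha, hb, hab, rfl⟩
        rw [norm_exp_neg_sq]
        apply Real.exp_le_exp.2
        have e1 : (a • ((z.re + T : ℝ) : ℂ) + b • (z + T)).re = z.re + T := by
          simp; linear_combination (z.re + T) * hab
        have e2 : (a • ((z.re + T : ℝ) : ℂ) + b • (z + T)).im = b * z.im := by simp
        rw [e1, e2]
        have : b ^ 2 ≤ 1 := by nlinarith
        nlinarith [mul_le_mul_of_nonneg_right this (sq_nonneg z.im)]
    refine squeeze_zero_norm hb ?_
    have h4 : Tendsto (fun T : ℝ => Real.exp (-(z.re + T) ^ 2)) atTop (𝓝 0) := by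
      refine Real.tendsto_exp_neg_atTop_nhds_zero.comp
        ((tendsto_pow_atTop two_ne_zero).comp (tendsto_atTop_add_const_left atTop z.re tendsto_id))
    simpa using h4.const_mul (Real.exp (z.im ^ 2) * |z.im|)
  simpa using h3.add h1

/-- `|erfc z| ≤ |exp (-z²)|` on the right half plane. -/
theorem norm_cerfc_le {z : ℂ} (hz : 0 ≤ z.re) :
    ‖cerfc z‖ ≤ Real.exp (z.im ^ 2 - z.re ^ 2) := by
  have hs : Real.sqrt Real.pi ≠ 0 := by positivity
  -- Along the horizontal ray from `z`, `|exp(-(z+v)²)| ≤ |exp(-z²)| exp(-v²)`, because the cross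
  -- term `2 v Re z` is nonnegative.
  have hb : ∀ T : ℝ, 0 ≤ T → ‖gaussPrim (z + T) - gaussPrim z‖ ≤
      Real.exp (z.im ^ 2 - z.re ^ 2) * (Real.sqrt Real.pi / 2) := fun T hT => by
    have h0 := gaussPrim_add_sub z 0 T
    simp only [ofReal_zero, add_zero] at h0
    rw [h0]
    calc _ ≤ ∫ v in (0 : ℝ)..T, Real.exp (z.im ^ 2 - z.re ^ 2) * Real.exp (-v ^ 2) := by
          refine intervalIntegral.norm_integral_le_of_norm_le hT ?_
            (by apply Continuous.intervalIntegrable; fun_prop)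
          refine ae_of_all _ fun v hv => ?_
          rw [norm_exp_neg_sq, ← Real.exp_add]
          apply Real.exp_le_exp.2
          simp
          nlinarith [mul_nonneg hz hv.1.le]
      _ = Real.exp (z.im ^ 2 - z.re ^ 2) * ∫ v in Set.Ioc 0 T, Real.exp (-v ^ 2) := by
          rw [intervalIntegral.integral_const_mul, intervalIntegral.integral_of_le hT]
      _ ≤ _ := by
          gcongr
          rw [← integral_Ioi_zero_exp_neg_sq]
          exact setIntegral_mono_set integrable_exp_neg_sq.integrableOn
            (ae_of_all _ fun _ => (Real.exp_pos _).le) (Set.Ioc_subset_Ioi_self).eventuallyLE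
  have hl := le_of_tendsto ((tendsto_gaussPrim_add z).sub_const (gaussPrim z)).norm
    ((eventually_ge_atTop 0).mono hb)
  have he : cerfc z = 2 / (Real.sqrt Real.pi : ℂ) *
      (((Real.sqrt Real.pi / 2 : ℝ) : ℂ) - gaussPrim z) := by
    have : (Real.sqrt Real.pi : ℂ) ≠ 0 := by exact_mod_cast hs
    rw [cerfc]; push_cast; field_simp
  rw [he, norm_mul]
  have hn : ‖2 / (Real.sqrt Real.pi : ℂ)‖ = 2 / Real.sqrt Real.pi := by
    rw [norm_div, norm_real, Real.norm_of_nonneg (Real.sqrt_nonneg _)]; simp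
  rw [hn]
  calc _ ≤ 2 / Real.sqrt Real.pi * (Real.exp (z.im ^ 2 - z.re ^ 2) * (Real.sqrt Real.pi / 2)) := by
        gcongr
    _ = _ := by field_simp

theorem norm_cerfc_le_of_nonpos {z : ℂ} (hz : z.re ≤ 0) :
    ‖cerfc z‖ ≤ 2 + Real.exp (z.im ^ 2 - z.re ^ 2) := by
  have h := norm_cerfc_le (z := -z) (by simpa using hz)
  have e : cerfc z = 2 - cerfc (-z) := by rw [cerfc_neg]; ring
  rw [e]
  refine (norm_sub_le _ _).trans ?_
  simpa using h

theorem erfc_le_exp {x : ℝ} (hx : 0 ≤ x) : erfc x ≤ Real.exp (-x ^ 2) := by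
  have h := norm_cerfc_le (z := x) (by simpa using hx)
  rw [cerfc_ofReal, norm_real] at h
  simpa using (le_abs_self _).trans h

/-- This function is an antiderivative of `erfc`; its limit at infinity gives the integral of `erfc`
over a half line. -/
theorem tendsto_erfc_primitive :
    Tendsto (fun x : ℝ => x * erfc x - Real.exp (-x ^ 2) / Real.sqrt Real.pi) atTop (𝓝 0) := by
  have h1 : Tendsto (fun x : ℝ => Real.exp (-x ^ 2)) atTop (𝓝 0) :=
    Real.tendsto_exp_neg_atTop_nhds_zero.comp (tendsto_pow_atTop two_ne_zero)
  have h2 : Tendsto (fun x : ℝ => x * Real.exp (-x ^ 2)) atTop (𝓝 0) := by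
    have h3 : Tendsto (fun x : ℝ => x ^ 1 * Real.exp (-x)) atTop (𝓝 0) :=
      Real.tendsto_pow_mul_exp_neg_atTop_nhds_zero 1
    refine squeeze_zero' ((eventually_ge_atTop 0).mono fun x hx => by positivity)
      ((eventually_ge_atTop 1).mono fun x hx => ?_) h3
    rw [pow_one]
    gcongr
    nlinarith
  have h4 : Tendsto (fun x : ℝ => x * erfc x) atTop (𝓝 0) :=
    squeeze_zero' ((eventually_ge_atTop 0).mono fun x hx => mul_nonneg hx (erfc_nonneg x))
      ((eventually_ge_atTop 0).mono fun x hx => mul_le_mul_of_nonneg_left (erfc_le_exp hx) hx) h2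
  simpa using h4.sub (h1.div_const (Real.sqrt Real.pi))

theorem hasDerivAt_erfc_primitive (x : ℝ) :
    HasDerivAt (fun x : ℝ => x * erfc x - Real.exp (-x ^ 2) / Real.sqrt Real.pi) (erfc x) x := by
  have h1 := (hasDerivAt_id x).mul (hasDerivAt_erfc x)
  have h2 : HasDerivAt (fun x : ℝ => Real.exp (-x ^ 2)) (Real.exp (-x ^ 2) * (-(2 * x))) x := by
    have := ((hasDerivAt_pow 2 x).neg).exp
    simpa using this
  refine (h1.sub (h2.div_const (Real.sqrt Real.pi))).congr_deriv ?_
  simp only [id_eq]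
  ring

theorem integrableOn_erfc (a : ℝ) : IntegrableOn erfc (Set.Ioi a) :=
  integrableOn_Ioi_deriv_of_nonneg' (fun x _ => hasDerivAt_erfc_primitive x)
    (fun x _ => erfc_nonneg x) tendsto_erfc_primitive

theorem integral_Ioi_erfc (a : ℝ) :
    ∫ x in Set.Ioi a, erfc x = Real.exp (-a ^ 2) / Real.sqrt Real.pi - a * erfc a := by
  rw [integral_Ioi_of_hasDerivAt_of_nonneg' (fun x _ => hasDerivAt_erfc_primitive x)
    (fun x _ => erfc_nonneg x) tendsto_erfc_primitive]
  ring

/-! ### The entire weight that replaces `w(|x|)`. -/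

/-- The smooth even weight `(erfc (x / p - q) - erfc (x / p + q)) / 2`. -/
def smoothWeight (p q x : ℝ) : ℝ := (erfc (x / p - q) - erfc (x / p + q)) / 2

/-- The entire extension of `smoothWeight`. -/
def csmoothWeight (p q : ℝ) (z : ℂ) : ℂ := (cerfc (z / p - q) - cerfc (z / p + q)) / 2

theorem csmoothWeight_ofReal (p q x : ℝ) : csmoothWeight p q x = smoothWeight p q x := by
  simp only [csmoothWeight, smoothWeight]
  push_cast
  rw [← cerfc_ofReal, ← cerfc_ofReal]
  push_cast; rfl

theorem differentiable_csmoothWeight (p q : ℝ) : Differentiable ℂ (csmoothWeight p q) := by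
  have h1 : Differentiable ℂ fun z : ℂ => cerfc (z / p - q) :=
    differentiable_cerfc.comp ((differentiable_id.div_const _).sub_const _)
  have h2 : Differentiable ℂ fun z : ℂ => cerfc (z / p + q) :=
    differentiable_cerfc.comp ((differentiable_id.div_const _).add_const _)
  exact (h1.sub h2).div_const 2

theorem csmoothWeight_eq_integral (p q : ℝ) (z : ℂ) :
    csmoothWeight p q z =
      1 / (Real.sqrt Real.pi : ℂ) * ∫ v in (-q)..q, exp (-(z / p + v) ^ 2) := by
  rw [← gaussPrim_add_sub]
  simp only [csmoothWeight, cerfc, ofReal_neg, ← sub_eq_add_neg]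
  ring

theorem smoothWeight_eq_integral (p q x : ℝ) :
    smoothWeight p q x =
      1 / Real.sqrt Real.pi * ∫ v in (-q)..q, Real.exp (-(x / p + v) ^ 2) := by
  have h := csmoothWeight_eq_integral p q x
  rw [csmoothWeight_ofReal] at h
  have e : (fun v : ℝ => exp (-((x : ℂ) / p + v) ^ 2)) =
      fun v : ℝ => ((Real.exp (-(x / p + v) ^ 2) : ℝ) : ℂ) := by
    ext v; push_cast; rfl
  rw [e, intervalIntegral.integral_ofReal] at h
  exact_mod_cast h

/-- `W` is an average of Gaussians `exp(-(z/p + v)²)` over `|v| ≤ q`, and leaving the real axis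
multiplies the modulus of each by at most `exp(Im(z)²/p²)`. This supplies the unimodal majorant on
the strip. -/
theorem norm_csmoothWeight_le {q : ℝ} (p : ℝ) (hq : 0 ≤ q) (z : ℂ) :
    ‖csmoothWeight p q z‖ ≤ Real.exp (z.im ^ 2 / p ^ 2) * smoothWeight p q z.re := by
  rw [csmoothWeight_eq_integral, smoothWeight_eq_integral, norm_mul]
  have hn : ‖1 / (Real.sqrt Real.pi : ℂ)‖ = 1 / Real.sqrt Real.pi := by
    rw [norm_div, norm_real, Real.norm_of_nonneg (Real.sqrt_nonneg _)]; simp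
  rw [hn, mul_left_comm, ← intervalIntegral.integral_const_mul]
  gcongr
  refine intervalIntegral.norm_integral_le_of_norm_le (by linarith) ?_
    (by apply Continuous.intervalIntegrable; fun_prop)
  refine ae_of_all _ fun v _ => ?_
  rw [norm_exp_neg_sq, ← Real.exp_add]
  apply Real.exp_le_exp.2
  simp only [add_re, add_im, div_ofReal_re, div_ofReal_im, ofReal_re, ofReal_im, add_zero, div_pow]
  linarith

theorem smoothWeight_nonneg {p q : ℝ} (hq : 0 ≤ q) (x : ℝ) : 0 ≤ smoothWeight p q x :=
  div_nonneg (sub_nonneg.2 (erfc_antitone (by linarith))) two_pos.le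

theorem smoothWeight_neg (p q x : ℝ) : smoothWeight p q (-x) = smoothWeight p q x := by
  have h1 : -x / p - q = -(x / p + q) := by ring
  have h2 : -x / p + q = -(x / p - q) := by ring
  simp only [smoothWeight, h1, h2, erfc_neg]
  ring

theorem smoothWeight_zero (p q : ℝ) : smoothWeight p q 0 = 1 - erfc q := by
  simp only [smoothWeight, zero_div, zero_sub, zero_add, erfc_neg]
  ring

theorem continuous_smoothWeight (p q : ℝ) : Continuous (smoothWeight p q) := by
  have := continuous_erfc
  unfold smoothWeight
  fun_prop

theorem smoothWeight_antitoneOn {p q : ℝ} (hp : 0 < p) (hq : 0 ≤ q) :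
    AntitoneOn (smoothWeight p q) (Set.Ici 0) := by
  have hd : ∀ x, HasDerivAt (smoothWeight p q)
      ((-(2 / Real.sqrt Real.pi * Real.exp (-(x / p - q) ^ 2)) * (1 / p) -
        -(2 / Real.sqrt Real.pi * Real.exp (-(x / p + q) ^ 2)) * (1 / p)) / 2) x := fun x => by
    have h1 : HasDerivAt (fun x : ℝ => x / p - q) (1 / p) x :=
      ((hasDerivAt_id x).div_const p).sub_const q
    have h2 : HasDerivAt (fun x : ℝ => x / p + q) (1 / p) x :=
      ((hasDerivAt_id x).div_const p).add_const q
    exact (((hasDerivAt_erfc _).comp x h1).sub ((hasDerivAt_erfc _).comp x h2)).div_const 2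
  refine antitoneOn_of_deriv_nonpos (convex_Ici 0) (continuous_smoothWeight p q).continuousOn
    (fun x _ => (hd x).differentiableAt.differentiableWithinAt) fun x hx => ?_
  rw [interior_Ici] at hx
  have hx : 0 < x := hx
  rw [(hd x).deriv]
  have h3 : Real.exp (-(x / p + q) ^ 2) ≤ Real.exp (-(x / p - q) ^ 2) := by
    apply Real.exp_le_exp.2
    have : 0 ≤ x / p * q := by positivity
    nlinarith
  have h4 : 2 / Real.sqrt Real.pi * Real.exp (-(x / p + q) ^ 2) * (1 / p) ≤
      2 / Real.sqrt Real.pi * Real.exp (-(x / p - q) ^ 2) * (1 / p) := by gcongr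
  linarith

theorem integrableOn_erfc_div_add {p : ℝ} (hp : 0 < p) (c : ℝ) :
    IntegrableOn (fun x => erfc (x / p + c)) (Set.Ioi 0) := by
  have h1 : IntegrableOn (fun y => erfc (y + c)) (Set.Ioi 0) := by
    have := integrableOn_erfc c
    rw [← (measurePreserving_add_right volume c).integrableOn_comp_preimage
      (Homeomorph.addRight c).measurableEmbedding] at this
    simpa [Function.comp_def] using this
  have h2 := (integrableOn_Ioi_comp_mul_right_iff (fun y => erfc (y + c)) 0
    (inv_pos.2 hp)).2 (by simpa using h1)
  simpa [div_eq_mul_inv] using h2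

theorem integral_Ioi_erfc_div_add {p : ℝ} (hp : 0 < p) (c : ℝ) :
    ∫ x in Set.Ioi 0, erfc (x / p + c) =
      p * (Real.exp (-c ^ 2) / Real.sqrt Real.pi - c * erfc c) := by
  have h := integral_comp_mul_right_Ioi (fun y => erfc (y + c)) 0 (inv_pos.2 hp)
  simp only [inv_inv, smul_eq_mul, ← div_eq_mul_inv] at h
  have h2 := (measurePreserving_add_right volume c).setIntegral_preimage_emb
    (Homeomorph.addRight c).measurableEmbedding erfc (Set.Ioi c)
  rw [Set.preimage_add_const_Ioi, sub_self] at h2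
  rw [h, zero_div, h2, integral_Ioi_erfc]

theorem integrableOn_smoothWeight {p : ℝ} (hp : 0 < p) (q : ℝ) :
    IntegrableOn (smoothWeight p q) (Set.Ioi 0) := by
  have h1 := integrableOn_erfc_div_add hp (-q)
  have h2 := integrableOn_erfc_div_add hp q
  simp only [← sub_eq_add_neg] at h1
  exact (h1.sub h2).div_const 2

theorem integral_Ioi_smoothWeight {p : ℝ} (hp : 0 < p) (q : ℝ) :
    ∫ x in Set.Ioi 0, smoothWeight p q x = p * q := by
  have h1 := integrableOn_erfc_div_add hp (-q)
  have h2 := integrableOn_erfc_div_add hp q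
  have e1 := integral_Ioi_erfc_div_add hp (-q)
  have e2 := integral_Ioi_erfc_div_add hp q
  simp only [← sub_eq_add_neg] at h1 e1
  simp only [smoothWeight]
  rw [integral_div, integral_sub h1 h2, e1, e2, erfc_neg]
  ring_nf

theorem integrable_comp_abs {φ : ℝ → ℝ} (hi : IntegrableOn φ (Set.Ioi 0)) :
    Integrable fun x => φ |x| := by
  have h1 : IntegrableOn (fun x => φ |x|) (Set.Ioi 0) :=
    hi.congr_fun (fun x hx => by rw [abs_of_pos hx]) measurableSet_Ioi
  have h2 : IntegrableOn (fun x => φ |x|) (Set.Iic 0) := by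
    rw [← Measure.map_neg_eq_self (volume : Measure ℝ)]
    let m : MeasurableEmbedding fun x : ℝ => -x := (Homeomorph.neg ℝ).measurableEmbedding
    rw [m.integrableOn_map_iff]
    simp_rw [Function.comp_def, abs_neg, Set.neg_preimage, Set.neg_Iic, neg_zero]
    exact Iff.mpr integrableOn_Ici_iff_integrableOn_Ioi h1
  rw [← integrableOn_univ, ← Set.Iic_union_Ioi (a := (0 : ℝ))]
  exact h2.union h1

theorem smoothWeight_abs (p q x : ℝ) : smoothWeight p q |x| = smoothWeight p q x := by
  rcases abs_choice x with h | h <;> rw [h]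
  exact smoothWeight_neg p q x

/-- Taken at `|x|`, this separates the corner of `w(|x|)` from its entire part: the corner lies in
the second term, which is at most `exp(-q²)/2` there. -/
theorem weight_eq (p q x : ℝ) : weight p q x = smoothWeight p q x + erfc (x / p + q) / 2 := by
  simp only [weight, smoothWeight]; ring

/-! ### Sums of unimodal functions over shifted integers. -/

/-- The terms after the first are bounded by the integral over `(y, ∞)`, and the missing piece over
`(0, y)` is at least `y ψ(y)`. -/
theorem tsum_antitone_le {ψ : ℝ → ℝ} (ha : AntitoneOn ψ (Set.Ici 0)) (h0 : ∀ x, 0 ≤ ψ x)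
    (hi : IntegrableOn ψ (Set.Ioi 0)) {y : ℝ} (hy : 0 ≤ y) :
    Summable (fun n : ℕ => ψ (y + n)) ∧
      ∑' n : ℕ, ψ (y + n) ≤ (1 - y) * ψ y + ∫ x in Set.Ioi 0, ψ x := by
  have hb : ∀ n : ℕ, ∑ i ∈ Finset.range n, ψ (y + i) ≤ (1 - y) * ψ y + ∫ x in Set.Ioi 0, ψ x := by
    intro n
    have hint : ∀ a b : ℝ, 0 ≤ a → a ≤ b → IntervalIntegrable ψ volume a b := fun a b h1 h2 => by
      rw [intervalIntegrable_iff_integrableOn_Ioc_of_le h2]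
      exact hi.mono_set fun x hx => lt_of_le_of_lt h1 hx.1
    have h1 : ∑ i ∈ Finset.range n, ψ (y + (i + 1 : ℕ)) ≤ ∫ x in y..y + n, ψ x :=
      AntitoneOn.sum_le_integral (ha.mono fun x hx => hy.trans hx.1)
    have h2 : y * ψ y ≤ ∫ x in (0 : ℝ)..y, ψ x := by
      have : ∫ x in (0 : ℝ)..y, ψ y ≤ ∫ x in (0 : ℝ)..y, ψ x :=
        intervalIntegral.integral_mono_on hy (by simp) (hint 0 y le_rfl hy)
          fun x hx => ha hx.1 hy hx.2
      simpa using this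
    have hyn : y ≤ y + n := by simp
    have h3 : (∫ x in (0 : ℝ)..y, ψ x) + ∫ x in y..y + n, ψ x = ∫ x in (0 : ℝ)..y + n, ψ x :=
      intervalIntegral.integral_add_adjacent_intervals (hint 0 y le_rfl hy) (hint _ _ hy hyn)
    have h4 : ∫ x in (0 : ℝ)..y + n, ψ x ≤ ∫ x in Set.Ioi 0, ψ x := by
      rw [intervalIntegral.integral_of_le (hy.trans hyn)]
      exact setIntegral_mono_set hi (ae_of_all _ h0) (Set.Ioc_subset_Ioi_self).eventuallyLE
    have h5 : ∑ i ∈ Finset.range n, ψ (y + i) ≤ ∑ i ∈ Finset.range (n + 1), ψ (y + i) :=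
      Finset.sum_le_sum_of_subset_of_nonneg (Finset.range_mono (Nat.le_succ n)) fun i _ _ => h0 _
    rw [Finset.sum_range_succ'] at h5
    simp only [Nat.cast_zero, add_zero] at h5
    linarith
  exact ⟨summable_of_sum_range_le (fun n => h0 _) hb,
    Real.tsum_le_of_sum_range_le (fun n => h0 _) hb⟩

/-- By evenness the negative indices form a sum starting at `1 - y`. The two boundary terms `(1 - y)
ψ(y)` and `y ψ(1 - y)` add up to at most `ψ(0)`, uniformly in `y`. -/
theorem tsum_int_even_le {ψ : ℝ → ℝ} (ha : AntitoneOn ψ (Set.Ici 0)) (h0 : ∀ x, 0 ≤ ψ x)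
    (hi : IntegrableOn ψ (Set.Ioi 0)) (he : ∀ x, ψ (-x) = ψ x) {y : ℝ} (hy : 0 ≤ y) (hy1 : y ≤ 1) :
    Summable (fun n : ℤ => ψ (y + n)) ∧
      ∑' n : ℤ, ψ (y + n) ≤ ψ 0 + 2 * ∫ x in Set.Ioi 0, ψ x := by
  obtain ⟨s1, l1⟩ := tsum_antitone_le ha h0 hi hy
  obtain ⟨s2, l2⟩ := tsum_antitone_le ha h0 hi (sub_nonneg.2 hy1)
  have e1 : (fun n : ℕ => ψ (y + n)) = fun n : ℕ => ψ (y + ((n : ℤ) : ℝ)) := by simp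
  have e2 : (fun n : ℕ => ψ (1 - y + n)) = fun n : ℕ => ψ (y + ((-(n + 1 : ℤ) : ℤ) : ℝ)) := by
    ext n
    rw [← he]
    congr 1
    push_cast
    ring
  have h := HasSum.of_nat_of_neg_add_one (f := fun n : ℤ => ψ (y + n)) (e1 ▸ s1.hasSum)
    (e2 ▸ s2.hasSum)
  refine ⟨h.summable, h.tsum_eq ▸ ?_⟩
  have h1 : ψ y ≤ ψ 0 := ha (Set.self_mem_Ici) hy hy
  have h2 : ψ (1 - y) ≤ ψ 0 := ha (Set.self_mem_Ici) (sub_nonneg.2 hy1) (sub_nonneg.2 hy1)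
  simp only [← e1, ← e2]
  nlinarith

/-! ### Fourier coefficients of periodic functions on a strip. -/

theorem memLp_two_of_continuous {f : ℝ → ℂ} (hf : ContinuousOn f (Set.Icc 0 1)) :
    MemLp f 2 (volume.restrict (Set.Ioc 0 1)) := by
  obtain ⟨C, hC⟩ := isCompact_Icc.exists_bound_of_continuousOn hf
  refine MemLp.of_bound ((hf.mono Set.Ioc_subset_Icc_self).aestronglyMeasurable
    measurableSet_Ioc) C ?_
  exact (ae_restrict_iff' measurableSet_Ioc).2
    (ae_of_all _ fun x hx => hC x (Set.Ioc_subset_Icc_self hx))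

theorem fourierCoeffOn_zero_one (f : ℝ → ℂ) (n : ℤ) :
    fourierCoeffOn (zero_lt_one' ℝ) f n =
      ∫ x in (0 : ℝ)..1, exp (-(2 * Real.pi * I * n * x)) * f x := by
  rw [fourierCoeffOn_eq_integral]
  simp only [sub_zero, div_one, one_smul, smul_eq_mul]
  congr 1
  ext x
  congr 1
  rw [fourier_coe_apply]
  congr 1
  push_cast
  ring

/-- Cauchy's theorem on a rectangle of width one period: the vertical sides cancel by periodicity.
-/
theorem fourierCoeffOn_shift {P : ℂ → ℂ} {y : ℝ}
    (hP : DifferentiableOn ℂ P (Set.uIcc 0 1 ×ℂ Set.uIcc 0 y))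
    (hper : ∀ z, P (z + 1) = P z) (n : ℤ) :
    fourierCoeffOn (zero_lt_one' ℝ) (fun x : ℝ => P x) n =
      exp (2 * Real.pi * n * y) *
        fourierCoeffOn (zero_lt_one' ℝ) (fun x : ℝ => P (x + y * I)) n := by
  have hd : DifferentiableOn ℂ (fun z => exp (-(2 * Real.pi * I * n * z)) * P z)
      (Set.uIcc 0 1 ×ℂ Set.uIcc 0 y) := by
    refine DifferentiableOn.mul ?_ hP
    fun_prop
  have h := integral_boundary_rect_eq_zero_of_differentiableOn
    (fun z => exp (-(2 * Real.pi * I * n * z)) * P z) 0 (1 + y * I) (by simpa using hd)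
  have hv : (∫ t : ℝ in (0 : ℝ)..y, exp (-(2 * Real.pi * I * n * (1 + t * I))) * P (1 + t * I)) =
      ∫ t : ℝ in (0 : ℝ)..y, exp (-(2 * Real.pi * I * n * (t * I))) * P (t * I) := by
    congr 1
    ext t
    rw [add_comm 1, hper]
    congr 1
    rw [exp_eq_exp_iff_exists_int]
    exact ⟨-n, by push_cast; ring⟩
  simp only [zero_re, zero_im, add_re, one_re, mul_re, ofReal_re, I_re, mul_zero, ofReal_im, I_im,
    mul_one, sub_self, add_zero, add_im, one_im, mul_im, zero_add, ofReal_zero, zero_mul,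
    ofReal_one] at h
  rw [hv, add_sub_cancel_right, sub_eq_zero] at h
  rw [fourierCoeffOn_zero_one, fourierCoeffOn_zero_one, h, ← intervalIntegral.integral_const_mul]
  congr 1
  ext x
  rw [← mul_assoc, ← exp_add]
  congr 2
  linear_combination (-2 * Real.pi * n * y : ℂ) * I_sq

theorem tsum_geometric_mul_le {r S : ℝ} {s : ℕ → ℝ} (hr0 : 0 ≤ r) (hr1 : r < 1)
    (hs0 : ∀ k, 0 ≤ s k) (hS : 0 ≤ S) (hs : Summable fun k => s k ^ 2)
    (hsS : ∑' k, s k ^ 2 ≤ S ^ 2) :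
    Summable (fun k => r ^ (k + 1) * s k) ∧
      ∑' k, r ^ (k + 1) * s k ≤ S * Real.sqrt (r ^ 2 / (1 - r ^ 2)) := by
  have hr2 : r ^ 2 < 1 := by nlinarith
  have hg : HasSum (fun k : ℕ => (r ^ (k + 1)) ^ 2) (r ^ 2 / (1 - r ^ 2)) := by
    have := (hasSum_geometric_of_lt_one (sq_nonneg r) hr2).mul_left (r ^ 2)
    refine (this.congr_fun fun k => ?_)
    ring
  have h := Real.summable_and_inner_le_Lp_mul_Lq_tsum_of_nonneg (Real.HolderConjugate.two_two)
    (f := fun k : ℕ => r ^ (k + 1)) (g := s) (fun k => by positivity) hs0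
    (by simpa using hg.summable) (by simpa using hs)
  refine ⟨h.1, h.2.trans ?_⟩
  simp only [Real.rpow_ofNat, ← Real.sqrt_eq_rpow]
  rw [hg.tsum_eq, mul_comm]
  gcongr
  exact Real.sqrt_le_iff.2 ⟨hS, hsS⟩

theorem norm_fourierCoeffOn_sq_le {g : ℝ → ℂ} {S : ℝ} (hg : ContinuousOn g (Set.Icc 0 1))
    (hb : ∀ x ∈ Set.Icc (0 : ℝ) 1, ‖g x‖ ≤ S) :
    Summable (fun n : ℤ => ‖fourierCoeffOn (zero_lt_one' ℝ) g n‖ ^ 2) ∧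
      ∑' n : ℤ, ‖fourierCoeffOn (zero_lt_one' ℝ) g n‖ ^ 2 ≤ S ^ 2 := by
  have h := hasSum_sq_fourierCoeffOn (zero_lt_one' ℝ) (memLp_two_of_continuous hg)
  refine ⟨h.summable, h.tsum_eq ▸ ?_⟩
  simp only [sub_zero, inv_one, one_smul]
  calc ∫ x in (0 : ℝ)..1, ‖g x‖ ^ 2 ≤ ∫ x in (0 : ℝ)..1, S ^ 2 := by
        refine intervalIntegral.integral_mono_on zero_le_one ?_ (by simp) fun x hx => ?_
        · apply ContinuousOn.intervalIntegrable
          rw [Set.uIcc_of_le zero_le_one]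
          exact hg.norm.pow 2
        · exact pow_le_pow_left₀ (norm_nonneg _) (hb x hx) 2
    _ = S ^ 2 := by simp

/-- `P 0` is the sum of the Fourier coefficients and the integral is the zeroth one. A height `δ' <
δ` is used because nothing is assumed on the edges of the strip. -/
theorem norm_sub_integral_le_of_lt {P : ℂ → ℂ} {δ δ' a B : ℝ} (hδ' : 0 < δ') (hlt : δ' < δ)
    (hP : DifferentiableOn ℂ P (Set.Icc 0 1 ×ℂ Set.Ioo (-δ) δ))
    (hper : ∀ z, P (z + 1) = P z)
    (hB : ∀ x ∈ Set.Icc (0 : ℝ) 1, ∀ y ∈ Set.Ioo (-δ) δ,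
      ‖P (x + y * I)‖ ≤ B * Real.exp (a * y)) :
    ‖P 0 - ∫ x in (0 : ℝ)..1, P x‖ ≤ B * (Real.exp (a * δ') + Real.exp (-(a * δ'))) *
      Real.sqrt (Real.exp (-(2 * Real.pi * δ')) ^ 2 /
        (1 - Real.exp (-(2 * Real.pi * δ')) ^ 2)) := by
  set r := Real.exp (-(2 * Real.pi * δ')) with hr
  have hr1 : r < 1 := Real.exp_lt_one_iff.2 (by have := Real.pi_pos; nlinarith [mul_pos this hδ'])
  have hB0 : 0 ≤ B := by
    have := (norm_nonneg _).trans (hB 0 (by simp) 0 (by constructor <;> linarith))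
    simpa using this
  set c : ℝ → ℤ → ℂ := fun y n => fourierCoeffOn (zero_lt_one' ℝ) (fun x : ℝ => P (x + y * I)) n
    with hc
  have hcont : ∀ y ∈ Set.Ioo (-δ) δ, ContinuousOn (fun x : ℝ => P (x + y * I)) (Set.Icc 0 1) :=
    fun y hy => hP.continuousOn.comp (by fun_prop) fun x hx => by
      simpa [mem_reProdIm] using ⟨hx, hy⟩
  have hbes : ∀ y ∈ Set.Ioo (-δ) δ, Summable (fun n : ℤ => ‖c y n‖ ^ 2) ∧
      ∑' n : ℤ, ‖c y n‖ ^ 2 ≤ (B * Real.exp (a * y)) ^ 2 := fun y hy =>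
    norm_fourierCoeffOn_sq_le (hcont y hy) fun x hx => hB x hx y hy
  have hshift : ∀ y ∈ Set.Ioo (-δ) δ, ∀ n : ℤ,
      ‖c 0 n‖ = Real.exp (2 * Real.pi * n * y) * ‖c y n‖ := fun y hy n => by
    have h := fourierCoeffOn_shift (P := P) (y := y) (hP.mono ?_) hper n
    · have : c 0 n = fourierCoeffOn (zero_lt_one' ℝ) (fun x : ℝ => P x) n := by simp [hc]
      rw [this, h, norm_mul, norm_exp]
      congr 2
      have : (2 * Real.pi * n * y : ℂ) = ((2 * Real.pi * n * y : ℝ) : ℂ) := by push_cast; rfl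
      rw [this, ofReal_re]
    · rw [Set.uIcc_of_le zero_le_one]
      refine Set.inter_subset_inter subset_rfl (Set.preimage_mono ?_)
      exact Set.OrdConnected.uIcc_subset Set.ordConnected_Ioo (by constructor <;> linarith) hy
  have hyp : δ' ∈ Set.Ioo (-δ) δ := by constructor <;> linarith
  have hyn : -δ' ∈ Set.Ioo (-δ) δ := by constructor <;> linarith
  have hpow : ∀ k : ℕ, r ^ (k + 1) = Real.exp (-(2 * Real.pi * (k + 1) * δ')) := fun k => by
    rw [hr, ← Real.exp_nat_mul]; congr 1; push_cast; ring
  -- Positive frequencies are shifted down to height `-δ'` and negative ones up to `δ'`; either way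
  -- the `(k+1)`-st coefficient gains the factor `r^(k+1)`.
  have hpos := tsum_geometric_mul_le (r := r) (S := B * Real.exp (a * -δ'))
    (s := fun k : ℕ => ‖c (-δ') ((k : ℤ) + 1)‖) (Real.exp_pos _).le hr1 (fun k => norm_nonneg _)
    (by positivity)
    ((hbes _ hyn).1.comp_injective (i := fun k : ℕ => (k : ℤ) + 1) fun a b h => by simpa using h)
    ((tsum_comp_le_tsum_of_inj (hbes _ hyn).1 (fun _ => by positivity)
      (i := fun k : ℕ => (k : ℤ) + 1) fun a b h => by simpa using h).trans (hbes _ hyn).2)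
  have hneg := tsum_geometric_mul_le (r := r) (S := B * Real.exp (a * δ'))
    (s := fun k : ℕ => ‖c δ' (-((k : ℤ) + 1))‖) (Real.exp_pos _).le hr1 (fun k => norm_nonneg _)
    (by positivity)
    ((hbes _ hyp).1.comp_injective (i := fun k : ℕ => -((k : ℤ) + 1)) fun a b h => by simpa using h)
    ((tsum_comp_le_tsum_of_inj (hbes _ hyp).1 (fun _ => by positivity)
      (i := fun k : ℕ => -((k : ℤ) + 1)) fun a b h => by simpa using h).trans (hbes _ hyp).2)
  have epos : (fun k : ℕ => r ^ (k + 1) * ‖c (-δ') ((k : ℤ) + 1)‖) =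
      fun k : ℕ => ‖c 0 ((k : ℤ) + 1)‖ := by
    ext k
    rw [hshift _ hyn, hpow]
    congr 2
    push_cast; ring
  have eneg : (fun k : ℕ => r ^ (k + 1) * ‖c δ' (-((k : ℤ) + 1))‖) =
      fun k : ℕ => ‖c 0 (-((k : ℤ) + 1))‖ := by
    ext k
    rw [hshift _ hyp, hpow]
    congr 2
    push_cast; ring
  rw [epos] at hpos
  rw [eneg] at hneg
  have h0mem : (0 : ℝ) ∈ Set.Ioo (-δ) δ := by constructor <;> linarith
  have hc0 := hcont 0 h0mem
  simp only [ofReal_zero, zero_mul, add_zero] at hc0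
  -- The Fourier series converges pointwise to `P` because `P` is continuous on the circle with
  -- absolutely summable coefficients.
  let F : C(AddCircle (1 : ℝ), ℂ) := ⟨AddCircle.liftIco 1 0 (fun x : ℝ => P x),
    AddCircle.liftIco_zero_continuous (by simpa using (hper 0).symm) hc0⟩
  have hF : ∀ n, fourierCoeff F n = c 0 n := fun n => by
    simp only [hc]
    rw [fourierCoeffOn_zero_one, fourierCoeff_eq_intervalIntegral _ _ 0]
    simp only [zero_add, div_one, one_smul]
    refine intervalIntegral.integral_congr_Ioo_of_le zero_le_one fun x hx => ?_
    change fourier (-n) (x : AddCircle (1 : ℝ)) • AddCircle.liftIco 1 0 (fun x : ℝ => P x) x = _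
    rw [AddCircle.liftIco_zero_coe_apply (Set.Ioo_subset_Ico_self hx), fourier_coe_apply,
      smul_eq_mul]
    simp only [ofReal_zero, zero_mul, add_zero]
    congr 2
    push_cast; ring
  have hsum : Summable fun n : ℤ => ‖c 0 n‖ := by
    refine Summable.of_nat_of_neg_add_one ?_ hneg.1
    rw [← summable_nat_add_iff 1]
    simpa using hpos.1
  have hFs : Summable (fourierCoeff F) := by
    rw [show fourierCoeff F = c 0 from funext hF]; exact hsum.of_norm
  have hval := has_pointwise_sum_fourier_series_of_summable hFs (0 : AddCircle (1 : ℝ))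
  have hF0 : F 0 = P 0 := by
    change AddCircle.liftIco 1 0 (fun x : ℝ => P x) ((0 : ℝ) : AddCircle (1 : ℝ)) = _
    rw [AddCircle.liftIco_zero_coe_apply (by simp)]
    simp
  simp only [fourier_eval_zero, smul_eq_mul, mul_one, hF, hF0] at hval
  have hzero : c 0 0 = ∫ x in (0 : ℝ)..1, P x := by
    simp only [hc]
    rw [fourierCoeffOn_zero_one]; simp
  have hs1 : Summable fun k : ℕ => c 0 ((k : ℤ) + 1) := hpos.1.of_norm
  have hs2 : Summable fun k : ℕ => c 0 (-((k : ℤ) + 1)) := hneg.1.of_norm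
  have hs0 : HasSum (fun k : ℕ => c 0 k) (∑' k : ℕ, c 0 ((k : ℤ) + 1) + c 0 0) := by
    rw [← hasSum_nat_add_iff' 1]
    simpa using hs1.hasSum
  have htot := hval.unique (HasSum.of_nat_of_neg_add_one hs0 hs2.hasSum)
  have : P 0 - ∫ x in (0 : ℝ)..1, P x =
      ∑' k : ℕ, c 0 ((k : ℤ) + 1) + ∑' k : ℕ, c 0 (-((k : ℤ) + 1)) := by
    rw [htot, hzero]; ring
  rw [this]
  calc _ ≤ ∑' k : ℕ, ‖c 0 ((k : ℤ) + 1)‖ + ∑' k : ℕ, ‖c 0 (-((k : ℤ) + 1))‖ :=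
        (norm_add_le _ _).trans (add_le_add (norm_tsum_le_tsum_norm hpos.1)
          (norm_tsum_le_tsum_norm hneg.1))
    _ ≤ _ := add_le_add hpos.2 hneg.2
    _ = _ := by rw [mul_neg]; ring

/-- A `1`-periodic function on a strip differs from its mean by an exponentially small amount: its
Fourier coefficients decay by shifting the contour, and Parseval's identity on the two shifted
lines together with the Cauchy-Schwarz inequality bounds their sum. -/
theorem norm_sub_integral_le {P : ℂ → ℂ} {δ a B : ℝ} (hδ : 0 < δ)
    (hP : DifferentiableOn ℂ P (Set.Icc 0 1 ×ℂ Set.Ioo (-δ) δ))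
    (hper : ∀ z, P (z + 1) = P z)
    (hB : ∀ x ∈ Set.Icc (0 : ℝ) 1, ∀ y ∈ Set.Ioo (-δ) δ,
      ‖P (x + y * I)‖ ≤ B * Real.exp (a * y)) :
    ‖P 0 - ∫ x in (0 : ℝ)..1, P x‖ ≤ B * (Real.exp (a * δ) + Real.exp (-(a * δ))) *
      Real.sqrt (Real.exp (-(2 * Real.pi * δ)) ^ 2 /
        (1 - Real.exp (-(2 * Real.pi * δ)) ^ 2)) := by
  have hlim : ContinuousAt (fun δ' => B * (Real.exp (a * δ') + Real.exp (-(a * δ'))) *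
      Real.sqrt (Real.exp (-(2 * Real.pi * δ')) ^ 2 /
        (1 - Real.exp (-(2 * Real.pi * δ')) ^ 2))) δ := by
    have h1 : Real.exp (-(2 * Real.pi * δ)) < 1 :=
      Real.exp_lt_one_iff.2 (by have := Real.pi_pos; nlinarith [mul_pos this hδ])
    have h2 : 1 - Real.exp (-(2 * Real.pi * δ)) ^ 2 ≠ 0 := by
      have := Real.exp_pos (-(2 * Real.pi * δ))
      nlinarith
    fun_prop (disch := assumption)
  refine ge_of_tendsto (hlim.tendsto.mono_left (nhdsWithin_le_nhds (s := Set.Iio δ))) ?_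
  filter_upwards [Ioo_mem_nhdsLT hδ] with δ' h
  exact norm_sub_integral_le_of_lt h.1 h.2 hP hper hB

/-! ### Discretization error of the trapezoidal rule. -/

/-- Poisson summation by hand: the periodization of `g` has value `∑ g n` at `0` and mean `∫ g`. -/
theorem norm_tsum_sub_integral_le {g : ℂ → ℂ} {ψ : ℝ → ℝ} {δ a A : ℝ} (hδ : 0 < δ) (hA : 0 ≤ A)
    (hg : DifferentiableOn ℂ g (strip δ))
    (hb : ∀ z ∈ strip δ, ‖g z‖ ≤ A * Real.exp (a * z.im) * ψ z.re)
    (ha : AntitoneOn ψ (Set.Ici 0)) (h0 : ∀ x, 0 ≤ ψ x)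
    (hi : IntegrableOn ψ (Set.Ioi 0)) (he : ∀ x, ψ (-x) = ψ x) :
    Summable (fun n : ℤ => g n) ∧ ‖∑' n : ℤ, g n - ∫ x : ℝ, g x‖ ≤
      A * (ψ 0 + 2 * ∫ x in Set.Ioi 0, ψ x) * (Real.exp (a * δ) + Real.exp (-(a * δ))) *
        Real.sqrt (Real.exp (-(2 * Real.pi * δ)) ^ 2 /
          (1 - Real.exp (-(2 * Real.pi * δ)) ^ 2)) := by
  have habs : ∀ x, ψ |x| = ψ x := fun x => by
    rcases abs_choice x with h | h <;> rw [h]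
    exact he x
  -- An open neighbourhood of the period cell, as uniform convergence to a holomorphic sum needs.
  -- There `|Re z| ≤ 2`, whence the shift by `2` in the majorant `u`.
  set U : Set ℂ := Set.Ioo (-1) 2 ×ℂ Set.Ioo (-δ) δ with hU
  have hUo : IsOpen U := isOpen_Ioo.reProdIm isOpen_Ioo
  have hUs : ∀ z ∈ U, ∀ n : ℤ, z + n ∈ strip δ := fun z hz n => by
    have : |z.im| < δ := abs_lt.2 hz.2
    simpa [strip] using this
  set u : ℤ → ℝ := fun n => A * Real.exp (|a| * δ) * ψ (max 0 (|(n : ℝ)| - 2)) with hu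
  have hus : Summable u := by
    refine Summable.mul_left _ ?_
    have h1 : Summable fun n : ℕ => ψ (max 0 ((n : ℝ) - 2)) := by
      rw [← summable_nat_add_iff 2]
      have := (tsum_antitone_le ha h0 hi le_rfl).1
      simpa using this
    refine Summable.of_nat_of_neg ?_ ?_ <;> simpa using h1
  have hbu : ∀ n : ℤ, ∀ z ∈ U, ‖g (z + n)‖ ≤ u n := fun n z hz => by
    refine (hb _ (hUs z hz n)).trans ?_
    have him : |(z + n).im| < δ := hUs z hz n
    have h1 : Real.exp (a * (z + n).im) ≤ Real.exp (|a| * δ) := by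
      apply Real.exp_le_exp.2
      calc _ ≤ |a * (z + n).im| := le_abs_self _
        _ = |a| * |(z + n).im| := abs_mul _ _
        _ ≤ _ := by gcongr
    have h2 : ψ (z + n).re ≤ ψ (max 0 (|(n : ℝ)| - 2)) := by
      rw [← habs]
      refine ha (Set.mem_Ici.2 (le_max_left _ _)) (Set.mem_Ici.2 (abs_nonneg _)) ?_
      refine max_le (abs_nonneg _) ?_
      have hz1 : |z.re| ≤ 2 := abs_le.2 ⟨by linarith [hz.1.1], hz.1.2.le⟩
      have : |(n : ℝ)| ≤ |(z + n).re| + |z.re| := by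
        have := abs_sub (z + n).re z.re
        simpa using this
      linarith
    have := h0 (z + n).re
    simp only [hu]
    gcongr
  set P : ℂ → ℂ := fun z => ∑' n : ℤ, g (z + n) with hP
  have hPd : DifferentiableOn ℂ P U := by
    refine differentiableOn_tsum_of_summable_norm hus (fun n => ?_) hUo hbu
    exact hg.comp (by fun_prop) fun z hz => hUs z hz n
  have hsub : Set.Icc (0 : ℝ) 1 ×ℂ Set.Ioo (-δ) δ ⊆ U :=
    Set.inter_subset_inter (Set.preimage_mono (Set.Icc_subset_Ioo (by norm_num) (by norm_num)))
      subset_rfl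
  have hper : ∀ z, P (z + 1) = P z := fun z => by
    simp only [hP]
    rw [← (Equiv.addRight (1 : ℤ)).tsum_eq fun n : ℤ => g (z + n)]
    congr 1
    ext n
    simp only [Equiv.coe_addRight]
    congr 1
    push_cast; ring
  have hPb : ∀ x ∈ Set.Icc (0 : ℝ) 1, ∀ y ∈ Set.Ioo (-δ) δ,
      ‖P (x + y * I)‖ ≤ A * (ψ 0 + 2 * ∫ x in Set.Ioi 0, ψ x) * Real.exp (a * y) := by
    intro x hx y hy
    obtain ⟨s, l⟩ := tsum_int_even_le ha h0 hi he hx.1 hx.2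
    have hz : (x + y * I : ℂ) ∈ U := hsub (by simpa [mem_reProdIm] using ⟨hx, hy⟩)
    have := tsum_of_norm_bounded (s.mul_left (A * Real.exp (a * y))).hasSum
      (f := fun n : ℤ => g (x + y * I + n)) fun n => by simpa using hb _ (hUs _ hz n)
    refine this.trans ?_
    rw [tsum_mul_left]
    calc _ ≤ A * Real.exp (a * y) * (ψ 0 + 2 * ∫ x in Set.Ioi 0, ψ x) := by gcongr
      _ = _ := by ring
  have hreal : ∀ x ∈ Set.Icc (0 : ℝ) 1, (x : ℂ) ∈ U := fun x hx =>
    hsub (by simpa [mem_reProdIm] using ⟨hx, hδ⟩)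
  have hgr : ∀ x : ℝ, (x : ℂ) ∈ strip δ := fun x => by simpa [strip] using hδ
  have hgc : Continuous fun x : ℝ => g x :=
    continuousOn_univ.1 (hg.continuousOn.comp (by fun_prop) fun x _ => hgr x)
  have hgi : Integrable fun x : ℝ => g x := by
    have hψi : Integrable fun x => A * ψ |x| := (integrable_comp_abs hi).const_mul A
    refine hψi.mono' hgc.aestronglyMeasurable (ae_of_all _ fun x => ?_)
    rw [habs]
    simpa using hb x (hgr x)
  have hint : ∫ x in (0 : ℝ)..1, P x = ∫ x : ℝ, g x := by
    have h1 : HasSum (fun n : ℤ => ∫ x in (0 : ℝ)..1, g ((x : ℂ) + n)) (∫ x in (0 : ℝ)..1, P x) := by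
      refine intervalIntegral.hasSum_integral_of_dominated_convergence (fun n _ => u n)
        (fun n => ?_) (fun n => ?_) ?_ ?_ ?_
      · have : Continuous fun x : ℝ => g ((x + n : ℝ) : ℂ) := hgc.comp (by fun_prop)
        push_cast at this
        exact this.aestronglyMeasurable
      · refine ae_of_all _ fun x hx => hbu n x (hreal x ?_)
        rw [Set.uIoc_of_le zero_le_one] at hx
        exact Set.Ioc_subset_Icc_self hx
      · exact ae_of_all _ fun _ _ => hus
      · simp
      · refine ae_of_all _ fun x hx => ?_
        rw [Set.uIoc_of_le zero_le_one] at hx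
        exact (Summable.of_norm_bounded hus fun n =>
          hbu n x (hreal x (Set.Ioc_subset_Icc_self hx))).hasSum
    have h2 := hgi.hasSum_intervalIntegral_comp_add_int
    push_cast at h2
    exact h1.unique h2
  have hmain := norm_sub_integral_le hδ (hPd.mono hsub) hper hPb
  rw [hint] at hmain
  refine ⟨?_, by simpa [hP] using hmain⟩
  have := Summable.of_norm_bounded hus fun n => hbu n (0 : ℝ) (hreal 0 (by simp))
  simpa using this

/-- Discretization error of the trapezoidal rule with step `h` for an analytic function on a strip
that is dominated by an even unimodal function. -/
theorem norm_trapezoid_sub_integral_le {g : ℂ → ℂ} {φ : ℝ → ℝ} {d h a A : ℝ} (hd : 0 < d)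
    (hh : 0 < h) (hA : 0 ≤ A) (hg : DifferentiableOn ℂ g (strip d))
    (hb : ∀ z ∈ strip d, ‖g z‖ ≤ A * Real.exp (a * z.im) * φ z.re)
    (ha : AntitoneOn φ (Set.Ici 0)) (h0 : ∀ x, 0 ≤ φ x)
    (hi : IntegrableOn φ (Set.Ioi 0)) (he : ∀ x, φ (-x) = φ x) :
    Summable (fun n : ℤ => g (n * h)) ∧ ‖h * ∑' n : ℤ, g (n * h) - ∫ x : ℝ, g x‖ ≤
      A * (h * φ 0 + 2 * ∫ x in Set.Ioi 0, φ x) * (Real.exp (a * d) + Real.exp (-(a * d))) *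
        Real.sqrt (Real.exp (-(2 * Real.pi * d / h)) ^ 2 /
          (1 - Real.exp (-(2 * Real.pi * d / h)) ^ 2)) := by
  have hs : ∀ z ∈ strip (d / h), z * h ∈ strip d := fun z hz => by
    have : |z.im| < d / h := hz
    rw [lt_div_iff₀ hh] at this
    simpa [strip, abs_mul, abs_of_pos hh] using this
  have key := norm_tsum_sub_integral_le (g := fun z => g (z * h)) (ψ := fun x => φ (x * h))
    (δ := d / h) (a := a * h) (A := A) (by positivity) hA
    (hg.comp (by fun_prop) hs)
    (fun z hz => by
      have := hb _ (hs z hz)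
      simpa [mul_assoc, mul_comm h] using this)
    (fun x hx y hy hxy => ha (Set.mem_Ici.2 (mul_nonneg hx hh.le))
      (Set.mem_Ici.2 (mul_nonneg hy hh.le)) (by gcongr))
    (fun x => h0 _)
    ((integrableOn_Ioi_comp_mul_right_iff φ 0 hh).2 (by simpa using hi))
    (fun x => by rw [neg_mul, he])
  refine ⟨key.1, ?_⟩
  have k2 := key.2
  have e1 : ∫ x : ℝ, g (x * h) = (h : ℂ)⁻¹ * ∫ x : ℝ, g x := by
    have := Measure.integral_comp_mul_right (fun x : ℝ => g x) h
    push_cast at this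
    rw [this, abs_of_pos (inv_pos.2 hh), real_smul, ofReal_inv]
  have e2 : ∫ x in Set.Ioi (0 : ℝ), φ (x * h) = h⁻¹ * ∫ x in Set.Ioi (0 : ℝ), φ x := by
    have := integral_comp_mul_right_Ioi φ 0 hh
    simpa using this
  rw [e1, e2] at k2
  have hhc : (h : ℂ) ≠ 0 := by exact_mod_cast hh.ne'
  have e3 : h * ∑' n : ℤ, g (n * h) - ∫ x : ℝ, g x =
      h * (∑' n : ℤ, g (n * h) - (h : ℂ)⁻¹ * ∫ x : ℝ, g x) := by field_simp
  rw [e3, norm_mul, norm_real, Real.norm_of_nonneg hh.le]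
  refine (mul_le_mul_of_nonneg_left k2 hh.le).trans (le_of_eq ?_)
  have e4 : a * h * (d / h) = a * d := by field_simp
  have e5 : 2 * Real.pi * (d / h) = 2 * Real.pi * d / h := by ring
  rw [e4, e5, zero_mul, ← mul_assoc, ← mul_assoc]
  congr 2
  field_simp

/-! ### Rotation of the contour. -/

theorem exists_primitive_on_lines {G : ℂ → ℂ} {K : Set ℂ} (hK : Convex ℝ K)
    (hG : DifferentiableOn ℂ G K) :
    ∃ g : ℂ → ℂ, ∀ (a c : ℂ) (s : ℝ), 0 ≤ s → (∀ t ∈ Set.Icc 0 s, a + t * c ∈ K) →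
      c * ∫ t in (0 : ℝ)..s, G (a + t * c) = g (a + s * c) - g a := by
  obtain ⟨g, hg⟩ := hK.exists_forall_hasDerivWithinAt hG
  refine ⟨g, fun a c s hs hmem => ?_⟩
  have hd : ∀ t ∈ Set.Icc 0 s, HasDerivWithinAt (fun t : ℝ => g (a + t * c))
      (c * G (a + t * c)) (Set.Icc 0 s) t := fun t ht => by
    have h1 : HasDerivWithinAt (fun t : ℝ => a + t * c) c (Set.Icc 0 s) t := by
      have := ((hasDerivAt_id (t : ℂ)).mul_const c).const_add a
      simpa using this.comp_ofReal.hasDerivWithinAt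
    have h2 := (hg _ (hmem t ht)).scomp t h1 (fun x hx => hmem x hx)
    exact h2.congr_deriv (by simp)
  have hcG : ContinuousOn (fun t : ℝ => c * G (a + t * c)) (Set.Icc 0 s) :=
    continuousOn_const.mul (hG.continuousOn.comp (by fun_prop) hmem)
  have h3 := intervalIntegral.integral_eq_sub_of_hasDerivAt_of_le hs
    (fun t ht => (hd t ht).continuousWithinAt)
    (fun t ht => (hd t (Set.Ioo_subset_Icc_self ht)).hasDerivAt (Icc_mem_nhds ht.1 ht.2))
    (hcG.intervalIntegrable_of_Icc hs)
  rw [intervalIntegral.integral_const_mul] at h3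
  simpa using h3

theorem convex_cone (β : ℝ) : Convex ℝ {z : ℂ | |z.im| ≤ β * z.re} := by
  have : {z : ℂ | |z.im| ≤ β * z.re} =
      {z : ℂ | z.im - β * z.re ≤ 0} ∩ {z : ℂ | -z.im - β * z.re ≤ 0} := by
    ext z
    simp only [Set.mem_ofPred_eq, Set.mem_inter_iff, abs_le]
    constructor
    · rintro ⟨h1, h2⟩; constructor <;> linarith
    · rintro ⟨h1, h2⟩; constructor <;> linarith
  rw [this]
  refine Convex.inter (convex_halfSpace_le ?_ 0) (convex_halfSpace_le ?_ 0)
  · exact ⟨fun x y => by simp; ring, fun c x => by simp; ring⟩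
  · exact ⟨fun x y => by simp; ring, fun c x => by simp; ring⟩

/-- Cauchy's theorem on the triangle `0`, `R`, `R(1 + iσβ)`; a primitive on the closed convex cone
makes the three sides telescope. -/
theorem integral_rotate {G : ℂ → ℂ} {β σ R : ℝ} (hβ : 0 ≤ β) (hσ : |σ| = 1) (hR : 0 ≤ R)
    (hG : DifferentiableOn ℂ G {z : ℂ | |z.im| ≤ β * z.re}) :
    ∫ x in (0 : ℝ)..R, G x = (1 + σ * β * I) * (∫ x in (0 : ℝ)..R, G (x * (1 + σ * β * I))) -
      σ * I * ∫ s in (0 : ℝ)..β * R, G (R + s * (σ * I)) := by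
  obtain ⟨g, hg⟩ := exists_primitive_on_lines (convex_cone β) hG
  have h1 := hg 0 1 R hR fun t ht => by
    simpa using mul_nonneg hβ ht.1
  have h2 := hg 0 (1 + σ * β * I) R hR fun t ht => by
    simp [abs_mul, hσ, abs_of_nonneg hβ, abs_of_nonneg ht.1, mul_comm]
  have h3 := hg R (σ * I) (β * R) (by positivity) fun t ht => by
    simpa [abs_mul, hσ, abs_of_nonneg ht.1] using ht.2
  simp only [zero_add, mul_one, one_mul] at h1 h2 h3
  rw [h1, h2, h3]
  have e : (R : ℂ) * (1 + σ * β * I) = R + (β * R : ℝ) * (σ * I) := by push_cast; ring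
  rw [e]
  ring

theorem one_sub_weight (p q x : ℝ) : ((1 - weight p q x : ℝ) : ℂ) = cerfc (q - x / p) / 2 := by
  have : (q - x / p : ℂ) = ((-(x / p - q) : ℝ) : ℂ) := by push_cast; ring
  rw [this, cerfc_ofReal, erfc_neg, weight]
  push_cast; ring

theorem integral_gaussian_shift {κ : ℝ} (hκ : 0 < κ) (m : ℝ) :
    Integrable (fun x : ℝ => Real.exp (-κ * (x - m) ^ 2)) ∧
      ∫ x : ℝ, Real.exp (-κ * (x - m) ^ 2) = Real.sqrt (Real.pi / κ) := by
  refine ⟨(integrable_exp_neg_mul_sq hκ).comp_sub_right m, ?_⟩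
  rw [integral_sub_right_eq_self (fun x => Real.exp (-κ * x ^ 2)) m, integral_gaussian]

/-- The dominating function for the integrand along the rotated ray. -/
def rayBound (β p q ωd x : ℝ) : ℝ :=
  1 / 2 * Real.exp (β ^ 2 * (x / p) ^ 2 - (q - x / p) ^ 2 - β * ωd * x) +
    (Set.Ioi (p * q)).indicator (fun x => Real.exp (-(β * ωd) * x)) x

theorem integral_rayBound_le {β p q ωd : ℝ} (hβ : 0 < β) (hβ1 : β < 1) (hp : 0 < p)
    (hωd : 0 < ωd) (hpq : ωd * p = 2 * q) :
    IntegrableOn (rayBound β p q ωd) (Set.Ioi 0) ∧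
      ∫ x in Set.Ioi 0, rayBound β p q ωd x ≤
        p / 2 * Real.sqrt (Real.pi / (1 - β ^ 2)) * Real.exp (-(2 * β * q ^ 2 / (1 + β))) +
          Real.exp (-(2 * β * q ^ 2)) / (β * ωd) := by
  have hb2 : 0 < 1 - β ^ 2 := by nlinarith
  have hκ : 0 < (1 - β ^ 2) / p ^ 2 := by positivity
  have hq : 0 < q := by nlinarith [mul_pos hωd hp]
  -- With `ωd p = 2q` the exponent is quadratic in `x/p`, and completing the square puts its maximum
  -- at `x = pq/(1+β)`.
  have e1 : ∀ x, Real.exp (β ^ 2 * (x / p) ^ 2 - (q - x / p) ^ 2 - β * ωd * x) =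
      Real.exp (-(2 * β * q ^ 2 / (1 + β))) *
        Real.exp (-((1 - β ^ 2) / p ^ 2) * (x - p * q / (1 + β)) ^ 2) := by
    intro x
    rw [← Real.exp_add]
    congr 1
    have hw : ωd = 2 * q / p := by field_simp; linarith
    have : 1 + β ≠ 0 := by positivity
    rw [hw]
    field_simp
    ring
  obtain ⟨gi, gv⟩ := integral_gaussian_shift hκ (p * q / (1 + β))
  have hβω : 0 < β * ωd := by positivity
  have i1 : Integrable fun x => 1 / 2 *
      Real.exp (β ^ 2 * (x / p) ^ 2 - (q - x / p) ^ 2 - β * ωd * x) := by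
    have := (gi.const_mul (Real.exp (-(2 * β * q ^ 2 / (1 + β))))).const_mul (1 / 2)
    simpa only [e1] using this
  have i2 : Integrable ((Set.Ioi (p * q)).indicator fun x => Real.exp (-(β * ωd) * x)) := by
    rw [integrable_indicator_iff measurableSet_Ioi]
    exact exp_neg_integrableOn_Ioi _ hβω
  have i3 : Integrable (rayBound β p q ωd) := i1.add i2
  have h0 : ∀ x, 0 ≤ rayBound β p q ωd x := fun x =>
    add_nonneg (by positivity) (Set.indicator_nonneg (fun _ _ => (Real.exp_pos _).le) _)
  refine ⟨i3.integrableOn, (setIntegral_le_integral i3 (ae_of_all _ h0)).trans (le_of_eq ?_)⟩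
  simp only [rayBound]
  rw [integral_add i1 i2, integral_const_mul]
  simp only [e1]
  rw [integral_const_mul, gv,
    integral_indicator measurableSet_Ioi, integral_exp_mul_Ioi (neg_lt_zero.2 hβω)]
  congr 1
  · have : Real.pi / ((1 - β ^ 2) / p ^ 2) = Real.pi / (1 - β ^ 2) * p ^ 2 := by field_simp
    rw [this, Real.sqrt_mul (by positivity), Real.sqrt_sq hp.le]
    ring
  · have : -(β * ωd) * (p * q) = -(2 * β * q ^ 2) := by linear_combination -β * q * hpq
    rw [this]
    field_simp

theorem norm_exp_neg_I_mul (ω : ℝ) (z : ℂ) : ‖exp (-I * ω * z)‖ = Real.exp (ω * z.im) := by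
  rw [norm_exp]; congr 1; simp

/-- The argument of `cerfc` has real part `q - x/p`, so the bound for the left half plane, with its
extra constant, is needed only beyond `x = pq`. -/
theorem norm_cerfc_ray_le {β p q x : ℝ} {σ : ℝ} (hσ : |σ| = 1) (hp : 0 < p) :
    ‖cerfc (q - x * (1 + σ * β * I) / p) / 2‖ ≤
      1 / 2 * Real.exp (β ^ 2 * (x / p) ^ 2 - (q - x / p) ^ 2) +
        (Set.Ioi (p * q)).indicator (fun _ => (1 : ℝ)) x := by
  have hre : (q - x * (1 + σ * β * I) / p : ℂ).re = q - x / p := by simp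
  have him : (q - x * (1 + σ * β * I) / p : ℂ).im = -(x * (σ * β) / p) := by simp
  have hsq : (-(x * (σ * β) / p)) ^ 2 = β ^ 2 * (x / p) ^ 2 := by
    have : σ ^ 2 = 1 := by rw [← sq_abs, hσ, one_pow]
    field_simp
    linear_combination x ^ 2 * β ^ 2 * this
  rw [norm_div, RCLike.norm_two]
  by_cases hx : x ∈ Set.Ioi (p * q)
  · have h : q - x / p ≤ 0 := by
      rw [sub_nonpos, le_div_iff₀ hp, mul_comm]; exact le_of_lt hx
    have := norm_cerfc_le_of_nonpos (z := q - x * (1 + σ * β * I) / p) (by rwa [hre])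
    rw [hre, him, hsq] at this
    rw [Set.indicator_of_mem hx]
    linarith
  · have h : 0 ≤ q - x / p := by
      rw [sub_nonneg, div_le_iff₀ hp, mul_comm]; exact not_lt.1 hx
    have := norm_cerfc_le (z := q - x * (1 + σ * β * I) / p) (by rwa [hre])
    rw [hre, him, hsq] at this
    rw [Set.indicator_of_notMem hx]
    linarith

/-- The integral over the positive half line converges after rotation to the ray of slope `± β`. -/
theorem tendsto_integral_rotated {f : ℂ → ℂ} {M β p q ω ωd : ℝ} (hβ : 0 < β) (hβ1 : β < 1)
    (hp : 0 < p) (hωd : 0 < ωd) (hω : ωd ≤ |ω|) (hpq : ωd * p = 2 * q)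
    (hf : DifferentiableOn ℂ f {z : ℂ | |z.im| ≤ β * z.re})
    (hM : ∀ z : ℂ, |z.im| ≤ β * z.re → ‖f z‖ ≤ M)
    (hdecay : ∀ ε > 0, ∀ᶠ R : ℝ in atTop, ∀ t : ℝ, |t| ≤ β * R → ‖f (R + t * I)‖ ≤ ε) :
    ∃ L : ℂ, Tendsto (fun R : ℝ => ∫ x in (0 : ℝ)..R,
        ((1 - weight p q x : ℝ) : ℂ) * (f x * exp (-I * ω * x))) atTop (𝓝 L) ∧
      ‖L‖ ≤ M * Real.sqrt (1 + β ^ 2) *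
        (p / 2 * Real.sqrt (Real.pi / (1 - β ^ 2)) * Real.exp (-(2 * β * q ^ 2 / (1 + β))) +
          Real.exp (-(2 * β * q ^ 2)) / (β * ωd)) := by
  have hω0 : 0 < |ω| := hωd.trans_le hω
  -- The ray is turned to the side where `|e^{-iωz}| = exp(-|ω| |Im z|)`.
  obtain ⟨σ, hσ, hσω⟩ : ∃ σ : ℝ, |σ| = 1 ∧ ω * σ = -|ω| := by
    rcases le_total 0 ω with h | h
    · exact ⟨-1, by simp, by rw [abs_of_nonneg h]; ring⟩
    · exact ⟨1, by simp, by rw [abs_of_nonpos h]; ring⟩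
  have hM0 : 0 ≤ M := (norm_nonneg _).trans (hM 0 (by simp))
  set G : ℂ → ℂ := fun z => cerfc (q - z / p) / 2 * (f z * exp (-I * ω * z)) with hG
  have hGd : DifferentiableOn ℂ G {z : ℂ | |z.im| ≤ β * z.re} := by
    have h1 : Differentiable ℂ fun z : ℂ => cerfc (q - z / p) / 2 :=
      (differentiable_cerfc.comp ((differentiable_id.div_const _).const_sub _)).div_const _
    refine h1.differentiableOn.mul (hf.mul ?_)
    fun_prop
  have hGx : ∀ x : ℝ, ((1 - weight p q x : ℝ) : ℂ) * (f x * exp (-I * ω * x)) = G x := fun x => by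
    rw [one_sub_weight]
  simp only [hGx]
  have hmem : ∀ x : ℝ, 0 ≤ x →
      (x * (1 + σ * β * I) : ℂ) ∈ {z : ℂ | |z.im| ≤ β * z.re} := fun x hx => by
    simp [abs_mul, hσ, abs_of_nonneg hβ.le, abs_of_nonneg hx, mul_comm]
  obtain ⟨hbi, hbv⟩ := integral_rayBound_le (q := q) hβ hβ1 hp hωd hpq
  have hray : ∀ x : ℝ, 0 ≤ x → ‖G (x * (1 + σ * β * I))‖ ≤ M * rayBound β p q ωd x := by
    intro x hx
    have h1 := norm_cerfc_ray_le (β := β) (q := q) (x := x) hσ hp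
    have h2 := hM _ (hmem x hx)
    have h3 : ‖exp (-I * ω * (x * (1 + σ * β * I)))‖ ≤ Real.exp (-(β * ωd) * x) := by
      rw [norm_exp_neg_I_mul]
      apply Real.exp_le_exp.2
      have : (x * (1 + σ * β * I) : ℂ).im = x * (σ * β) := by simp
      rw [this]
      have h4 : ω * (x * (σ * β)) = -(β * |ω| * x) := by linear_combination x * β * hσω
      rw [h4, neg_mul]
      gcongr
    have h5 : rayBound β p q ωd x =
        (1 / 2 * Real.exp (β ^ 2 * (x / p) ^ 2 - (q - x / p) ^ 2) +
          (Set.Ioi (p * q)).indicator (fun _ => (1 : ℝ)) x) * Real.exp (-(β * ωd) * x) := by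
      rw [rayBound, add_mul, mul_assoc (1 / 2 : ℝ), ← Real.exp_add]
      congr 1
      · congr 2; ring
      · by_cases h : x ∈ Set.Ioi (p * q) <;> simp [h]
    rw [hG, h5]
    simp only [norm_mul]
    calc _ ≤ (1 / 2 * Real.exp (β ^ 2 * (x / p) ^ 2 - (q - x / p) ^ 2) +
          (Set.Ioi (p * q)).indicator (fun _ => (1 : ℝ)) x) *
            (M * Real.exp (-(β * ωd) * x)) :=
          mul_le_mul h1 (mul_le_mul h2 h3 (norm_nonneg _) hM0) (by positivity)
            ((norm_nonneg _).trans h1)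
      _ = _ := by ring
  have hGray : IntegrableOn (fun x : ℝ => G (x * (1 + σ * β * I))) (Set.Ioi 0) := by
    refine (hbi.const_mul M).mono' ?_ ?_
    · refine ContinuousOn.aestronglyMeasurable ?_ measurableSet_Ioi
      exact hGd.continuousOn.comp (by fun_prop) fun x hx => hmem x (le_of_lt hx)
    · exact (ae_restrict_iff' measurableSet_Ioi).2 (ae_of_all _ fun x hx => hray x (le_of_lt hx))
  have hlim := (intervalIntegral_tendsto_integral_Ioi 0 hGray tendsto_id).const_mul
    (1 + σ * β * I : ℂ)
  -- On the vertical side `f` tends to `0` uniformly and `e^{-iωz}` has integral at most `1/|ω|`.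
  -- Once `R ≥ pq/(1-β)`, the argument of `cerfc` has real part at least as large in modulus as its
  -- imaginary part, so the factor `cerfc/2` is at most `3/2`.
  have hvert : Tendsto (fun R : ℝ => σ * I * ∫ s in (0 : ℝ)..β * R, G (R + s * (σ * I))) atTop
      (𝓝 0) := by
    rw [Metric.tendsto_nhds]
    intro ε hε
    have hε' : 0 < ε * |ω| / 3 := by positivity
    filter_upwards [hdecay _ hε', eventually_ge_atTop (p * q / (1 - β)), eventually_ge_atTop 0]
      with R h1 h2 h3
    rw [div_le_iff₀ (by linarith)] at h2
    have hpt : ∀ s ∈ Set.Ioc 0 (β * R), ‖G (R + s * (σ * I))‖ ≤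
        ε * |ω| / 2 * Real.exp (-|ω| * s) := by
      intro s hs
      have hre : (q - (R + s * (σ * I)) / p : ℂ).re = q - R / p := by simp
      have him : (q - (R + s * (σ * I)) / p : ℂ).im = -(s * σ / p) := by simp
      have hsq : (-(s * σ / p)) ^ 2 = (s / p) ^ 2 := by
        have : σ ^ 2 = 1 := by rw [← sq_abs, hσ, one_pow]
        field_simp
        linear_combination s ^ 2 * this
      have hsR : s / p ≤ R / p - q := by
        have : p * q ≤ R - s := by nlinarith [hs.2]
        rw [le_sub_iff_add_le, ← sub_nonneg]
        have e : R / p - (s / p + q) = (R - s - p * q) / p := by field_simp; ring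
        rw [e]
        exact div_nonneg (by linarith) hp.le
      have hs0 : 0 ≤ s / p := div_nonneg hs.1.le hp.le
      have k1 : ‖cerfc (q - (R + s * (σ * I)) / p) / 2‖ ≤ 3 / 2 := by
        have := norm_cerfc_le_of_nonpos (z := q - (R + s * (σ * I)) / p) (by rw [hre]; linarith)
        rw [hre, him, hsq] at this
        have h4 : Real.exp ((s / p) ^ 2 - (q - R / p) ^ 2) ≤ 1 :=
          Real.exp_le_one_iff.2 (by nlinarith)
        rw [norm_div, RCLike.norm_two]
        linarith
      have k2 : ‖f (R + s * (σ * I))‖ ≤ ε * |ω| / 3 := by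
        have := h1 (s * σ) (by rw [abs_mul, hσ, mul_one, abs_of_pos hs.1]; exact hs.2)
        push_cast at this
        rwa [mul_assoc] at this
      have k3 : ‖exp (-I * ω * (R + s * (σ * I)))‖ = Real.exp (-|ω| * s) := by
        rw [norm_exp_neg_I_mul]
        congr 1
        simp
        linear_combination s * hσω
      rw [hG]
      simp only [norm_mul]
      rw [k3]
      calc _ ≤ 3 / 2 * (ε * |ω| / 3 * Real.exp (-|ω| * s)) := by gcongr
        _ = _ := by ring
    have hβR : 0 ≤ β * R := by positivity
    have hI : ‖∫ s in (0 : ℝ)..β * R, G (R + s * (σ * I))‖ ≤ ε / 2 := by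
      calc _ ≤ ∫ s in (0 : ℝ)..β * R, ε * |ω| / 2 * Real.exp (-|ω| * s) :=
            intervalIntegral.norm_integral_le_of_norm_le hβR (ae_of_all _ hpt)
              (by apply Continuous.intervalIntegrable; fun_prop)
        _ ≤ ∫ s in Set.Ioi 0, ε * |ω| / 2 * Real.exp (-|ω| * s) := by
            rw [intervalIntegral.integral_of_le hβR]
            exact setIntegral_mono_set ((exp_neg_integrableOn_Ioi 0 hω0).const_mul _)
              (ae_of_all _ fun s => by positivity) (Set.Ioc_subset_Ioi_self).eventuallyLE
        _ = ε / 2 := by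
            rw [integral_const_mul, integral_exp_mul_Ioi (neg_lt_zero.2 hω0)]
            simp only [mul_zero, Real.exp_zero]
            field_simp
    rw [dist_zero_right, norm_mul, norm_mul, norm_I, norm_real, Real.norm_eq_abs, hσ, one_mul,
      one_mul]
    linarith
  refine ⟨(1 + σ * β * I) * ∫ x in Set.Ioi (0 : ℝ), G (x * (1 + σ * β * I)), ?_, ?_⟩
  · have := hlim.sub hvert
    rw [sub_zero] at this
    refine this.congr' ?_
    filter_upwards [eventually_ge_atTop 0] with R hR
    exact (integral_rotate hβ.le hσ hR hGd).symm
  · have hn : ‖(1 + σ * β * I : ℂ)‖ = Real.sqrt (1 + β ^ 2) := by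
      have : (1 + σ * β * I : ℂ) = ((1 : ℝ) : ℂ) + ((σ * β : ℝ) : ℂ) * I := by push_cast; ring
      rw [this, norm_add_mul_I, mul_pow, ← sq_abs σ, hσ]
      norm_num
    rw [norm_mul, hn]
    have : ‖∫ x in Set.Ioi (0 : ℝ), G (x * (1 + σ * β * I))‖ ≤
        M * ∫ x in Set.Ioi 0, rayBound β p q ωd x := by
      rw [← integral_const_mul]
      exact norm_integral_le_of_norm_le (hbi.const_mul M)
        ((ae_restrict_iff' measurableSet_Ioi).2 (ae_of_all _ fun x hx => hray x (le_of_lt hx)))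
    calc _ ≤ Real.sqrt (1 + β ^ 2) * (M * (p / 2 * Real.sqrt (Real.pi / (1 - β ^ 2)) *
          Real.exp (-(2 * β * q ^ 2 / (1 + β))) + Real.exp (-(2 * β * q ^ 2)) / (β * ωd))) := by
          gcongr
          exact this.trans (by gcongr)
      _ = _ := by ring

/-! ### The complement of the weight integrated over the line. -/

theorem abs_arg_lt_arctan {α : ℝ} {z : ℂ} (hz : 0 < z.re) (h : |z.im| < α * z.re) :
    |arg z| < Real.arctan α := by
  have h1 : |arg z| < Real.pi / 2 := abs_arg_lt_pi_div_two_iff.2 (Or.inl hz)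
  have h2 := abs_lt.1 h1
  have h3 : arg z = Real.arctan (z.im / z.re) := by
    rw [← tan_arg, Real.arctan_tan h2.1 h2.2]
  have h4 := abs_lt.1 h
  rw [h3, abs_lt, ← Real.arctan_neg]
  constructor <;> apply Real.arctan_strictMono
  · rw [lt_div_iff₀ hz]; linarith
  · rw [div_lt_iff₀ hz]; linarith

theorem mem_doubleSector_of_re_pos {α : ℝ} {z : ℂ} (hz : 0 < z.re) (h : |z.im| < α * z.re) :
    z ∈ doubleSector α :=
  ⟨fun h0 => by simp [h0] at hz, Or.inl (abs_arg_lt_arctan hz h)⟩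

theorem neg_mem_doubleSector {α : ℝ} {z : ℂ} (hz : z ∈ doubleSector α) : -z ∈ doubleSector α :=
  ⟨neg_ne_zero.2 hz.1, by rw [neg_neg]; exact hz.2.symm⟩

theorem SectorAssumption.comp_neg {f : ℂ → ℂ} {α M : ℝ} (h : SectorAssumption f α M) :
    SectorAssumption (fun z => f (-z)) α M where
  analytic := fun z hz => (h.analytic (-z) (neg_mem_doubleSector hz)).comp_of_eq
    (analyticAt_id.neg) rfl
  bound := fun z hz => h.bound (-z) (neg_mem_doubleSector hz)
  decay_right := by
    rw [Metric.tendstoUniformlyOn_iff]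
    intro ε hε
    filter_upwards [Metric.tendstoUniformlyOn_iff.1 h.decay_left ε hε] with R hR β hβ
    have := hR (-β) ⟨by linarith [hβ.2], by linarith [hβ.1]⟩
    convert this using 3
    push_cast; ring
  decay_left := by
    rw [Metric.tendstoUniformlyOn_iff]
    intro ε hε
    filter_upwards [Metric.tendstoUniformlyOn_iff.1 h.decay_right ε hε] with R hR β hβ
    have := hR (-β) ⟨by linarith [hβ.2], by linarith [hβ.1]⟩
    convert this using 3
    push_cast; ring

/-- The bound for the contribution of one half line to the error of the continuous Euler
transform, as a function of the slope of the rotated ray. -/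
def halfLineBound (M p q ωd β : ℝ) : ℝ :=
  M * Real.sqrt (1 + β ^ 2) *
    (p / 2 * Real.sqrt (Real.pi / (1 - β ^ 2)) * Real.exp (-(2 * β * q ^ 2 / (1 + β))) +
      Real.exp (-(2 * β * q ^ 2)) / (β * ωd))

/-- The closed cone lies in the open sector except for its vertex, which the strip covers. -/
theorem cone_subset {α β d : ℝ} (hd : 0 < d) (hβα : β < α) {z : ℂ}
    (hz : |z.im| ≤ β * z.re) (hβ : 0 < β) : z ∈ strip d ∨ z ∈ doubleSector α := by
  have hre : 0 ≤ z.re := by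
    have := (abs_nonneg z.im).trans hz
    exact nonneg_of_mul_nonneg_right this hβ
  rcases hre.eq_or_lt with h | h
  · left
    rw [← h, mul_zero] at hz
    exact lt_of_le_of_lt hz hd
  · right
    exact mem_doubleSector_of_re_pos h (hz.trans_lt (by gcongr))

/-- Slope `β = α` is allowed although the sector is open: the limit `L` does not depend on the slope
`b < β` of the ray, so the bound passes to the limit `b → β`. -/
theorem tendsto_integral_half_line {f : ℂ → ℂ} {α d M β p q ω ωd : ℝ} (hd : 0 < d)
    (hs : SectorAssumption f α M) (han : AnalyticOnNhd ℂ f (strip d))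
    (hbd : ∀ z ∈ strip d, ‖f z‖ ≤ M)
    (hβ : 0 < β) (hβ1 : β < 1) (hβα : β ≤ α) (hp : 0 < p) (hωd : 0 < ωd) (hω : ωd ≤ |ω|)
    (hpq : ωd * p = 2 * q) :
    ∃ L : ℂ, Tendsto (fun R : ℝ => ∫ x in (0 : ℝ)..R,
        ((1 - weight p q x : ℝ) : ℂ) * (f x * exp (-I * ω * x))) atTop (𝓝 L) ∧
      ‖L‖ ≤ halfLineBound M p q ωd β := by
  have key : ∀ b : ℝ, 0 < b → b < β → ∃ L : ℂ, Tendsto (fun R : ℝ => ∫ x in (0 : ℝ)..R,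
        ((1 - weight p q x : ℝ) : ℂ) * (f x * exp (-I * ω * x))) atTop (𝓝 L) ∧
      ‖L‖ ≤ halfLineBound M p q ωd b := fun b hb hbβ => by
    have hbα := hbβ.trans_le hβα
    refine tendsto_integral_rotated hb (hbβ.trans hβ1) hp hωd hω hpq ?_ ?_ ?_
    · intro z hz
      rcases cone_subset hd hbα hz hb with h | h
      · exact (han z h).differentiableAt.differentiableWithinAt
      · exact (hs.analytic z h).differentiableAt.differentiableWithinAt
    · intro z hz
      rcases cone_subset hd hbα hz hb with h | h
      · exact hbd z h
      · exact hs.bound z h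
    · intro ε hε
      filter_upwards [Metric.tendstoUniformlyOn_iff.1 hs.decay_right ε hε, eventually_gt_atTop 0]
        with R hR hR0 t ht
      have h1 : |t / R| < α := by
        rw [abs_div, abs_of_pos hR0, div_lt_iff₀ hR0]
        exact ht.trans_lt (by gcongr)
      have h2 := hR (t / R) (abs_lt.1 h1)
      rw [dist_zero_left] at h2
      have h3 : (R + I * ((t / R : ℝ) : ℂ) * R : ℂ) = R + t * I := by
        have : (R : ℂ) ≠ 0 := by exact_mod_cast hR0.ne'
        push_cast; field_simp
      rw [h3] at h2
      exact h2.le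
  obtain ⟨L, hL, -⟩ := key (β / 2) (by linarith) (by linarith)
  refine ⟨L, hL, ?_⟩
  have hc : ContinuousAt (halfLineBound M p q ωd) β := by
    have h1 : 1 - β ^ 2 ≠ 0 := by nlinarith
    have h2 : 1 + β ≠ 0 := by positivity
    have h3 : β * ωd ≠ 0 := by positivity
    unfold halfLineBound
    fun_prop (disch := assumption)
  refine ge_of_tendsto (hc.tendsto.mono_left (nhdsWithin_le_nhds (s := Set.Iio β))) ?_
  filter_upwards [Ioo_mem_nhdsLT hβ] with b hb
  obtain ⟨L', hL', h⟩ := key b hb.1 hb.2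
  rwa [tendsto_nhds_unique hL hL']

theorem continuous_weight (p q : ℝ) : Continuous (weight p q) := by
  have := continuous_erfc
  unfold weight
  fun_prop

theorem continuous_ofReal_of_strip {f : ℂ → ℂ} {d : ℝ} (hd : 0 < d)
    (han : AnalyticOnNhd ℂ f (strip d)) : Continuous fun x : ℝ => f x :=
  continuousOn_univ.1 (han.continuousOn.comp (by fun_prop) fun x _ => by simpa [strip] using hd)

theorem tendsto_integral_one_sub_weight {f : ℂ → ℂ} {α d M β p q ω ωd : ℝ} (hd : 0 < d)
    (hs : SectorAssumption f α M) (han : AnalyticOnNhd ℂ f (strip d))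
    (hbd : ∀ z ∈ strip d, ‖f z‖ ≤ M)
    (hβ : 0 < β) (hβ1 : β < 1) (hβα : β ≤ α) (hp : 0 < p) (hωd : 0 < ωd) (hω : ωd ≤ |ω|)
    (hpq : ωd * p = 2 * q) :
    ∃ L : ℂ, Tendsto (fun R : ℝ × ℝ => ∫ x in R.1..R.2,
        ((1 - weight p q |x| : ℝ) : ℂ) * (f x * exp (-I * ω * x))) (atBot ×ˢ atTop) (𝓝 L) ∧
      ‖L‖ ≤ 2 * halfLineBound M p q ωd β := by
  obtain ⟨L₁, hL₁, hb₁⟩ := tendsto_integral_half_line hd hs han hbd hβ hβ1 hβα hp hωd hω hpq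
  have hstrip : ∀ z ∈ strip d, -z ∈ strip d := fun z hz => by
    simpa [strip] using hz
  -- The negative half line becomes the positive one for `f(-z)` at frequency `-ω`.
  obtain ⟨L₂, hL₂, hb₂⟩ := tendsto_integral_half_line (f := fun z => f (-z)) (ω := -ω) hd
    hs.comp_neg (fun z hz => (han (-z) (hstrip z hz)).comp_of_eq (analyticAt_id.neg) rfl)
    (fun z hz => hbd (-z) (hstrip z hz)) hβ hβ1 hβα hp hωd (by rwa [abs_neg]) hpq
  refine ⟨L₂ + L₁, ?_, (norm_add_le _ _).trans (by linarith)⟩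
  have hfst : Tendsto (fun R : ℝ × ℝ => -R.1) (atBot ×ˢ atTop) atTop :=
    tendsto_neg_atBot_atTop.comp tendsto_fst
  have hsnd : Tendsto (fun R : ℝ × ℝ => R.2) (atBot ×ˢ atTop) atTop := tendsto_snd
  refine ((hL₂.comp hfst).add (hL₁.comp hsnd)).congr' ?_
  filter_upwards [(eventually_le_atBot 0).prod_mk (eventually_ge_atTop 0)] with R hR
  set H : ℝ → ℂ := fun x => ((1 - weight p q |x| : ℝ) : ℂ) * (f x * exp (-I * ω * x)) with hH
  have hHc : Continuous H := by
    have h1 := continuous_weight p q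
    have h2 := continuous_ofReal_of_strip hd han
    exact (continuous_ofReal.comp (continuous_const.sub (h1.comp continuous_abs))).mul
      (h2.mul (by fun_prop))
  rw [← intervalIntegral.integral_add_adjacent_intervals (hHc.intervalIntegrable R.1 0)
    (hHc.intervalIntegrable 0 R.2)]
  congr 1
  · have := intervalIntegral.integral_comp_neg (a := 0) (b := -R.1) H
    rw [neg_neg, neg_zero] at this
    rw [← this]
    refine intervalIntegral.integral_congr fun x hx => ?_
    rw [Set.uIcc_of_le (by linarith [hR.1])] at hx
    simp only [hH, abs_neg, abs_of_nonneg hx.1]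
    push_cast
    congr 3
    ring
  · refine intervalIntegral.integral_congr fun x hx => ?_
    rw [Set.uIcc_of_le hR.2] at hx
    simp only [hH, abs_of_nonneg hx.1]

/-! ### Truncation and the tail of the weight. -/

theorem norm_exp_neg_I_mul_ofReal (ω x : ℝ) : ‖exp (-I * ω * x)‖ = 1 := by
  rw [norm_exp_neg_I_mul]; simp

theorem tsum_erfc_le {p q h : ℝ} (hp : 0 < p) (hh : 0 < h) :
    Summable (fun k : ℕ => erfc ((k + 1 : ℕ) * h / p + q)) ∧
      h * ∑' k : ℕ, erfc ((k + 1 : ℕ) * h / p + q) ≤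
        p * (Real.exp (-q ^ 2) / Real.sqrt Real.pi - q * erfc q) := by
  have ha : Antitone fun x : ℝ => erfc (x * h / p + q) := fun x y hxy =>
    erfc_antitone (by gcongr)
  have hi : IntegrableOn (fun x : ℝ => erfc (x * h / p + q)) (Set.Ioi 0) := by
    have := (integrableOn_Ioi_comp_mul_right_iff (fun x => erfc (x / p + q)) 0 hh).2
      (by simpa using integrableOn_erfc_div_add hp q)
    exact this
  obtain ⟨s, l⟩ := tsum_antitone_le (ha.antitoneOn _) (fun x => erfc_nonneg _) hi le_rfl
  have e : ∫ x in Set.Ioi (0 : ℝ), erfc (x * h / p + q) =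
      h⁻¹ * (p * (Real.exp (-q ^ 2) / Real.sqrt Real.pi - q * erfc q)) := by
    have := integral_comp_mul_right_Ioi (fun x => erfc (x / p + q)) 0 hh
    rw [this, zero_mul, integral_Ioi_erfc_div_add hp, smul_eq_mul]
  simp only [zero_add] at s l
  refine ⟨(summable_nat_add_iff 1).2 s, ?_⟩
  rw [s.tsum_eq_zero_add, e] at l
  simp only [Nat.cast_zero, sub_zero, one_mul, add_le_add_iff_left] at l
  calc _ ≤ h * (h⁻¹ * (p * (Real.exp (-q ^ 2) / Real.sqrt Real.pi - q * erfc q))) := by gcongr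
    _ = _ := by field_simp

/-- The truncated sum with the weight `w (|x|)` against the full sum with the smooth weight. -/
theorem norm_trapezoidalSum_sub_le {f : ℂ → ℂ} {M p q h ω : ℝ} {N : ℕ} (hp : 0 < p) (hh : 0 < h)
    (hq : 0 ≤ q) (hM : ∀ x : ℝ, ‖f x‖ ≤ M) (hN : N * h = 2 * p * q)
    (hsum : Summable fun n : ℤ =>
      (smoothWeight p q (n * h) : ℂ) * (f (n * h) * exp (-I * ω * (n * h)))) :
    ‖h * ∑' n : ℤ, (smoothWeight p q (n * h) : ℂ) * (f (n * h) * exp (-I * ω * (n * h))) -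
      trapezoidalSum f p q h N ω‖ ≤
      M * (2 * p * (Real.exp (-q ^ 2) / Real.sqrt Real.pi - q * erfc q) + h / 2 * erfc q) := by
  have hM0 : 0 ≤ M := (norm_nonneg _).trans (hM 0)
  set v : ℕ → ℝ := fun k => erfc (k * h / p + q) / 2 with hv
  have hv0 : ∀ k, 0 ≤ v k := fun k => div_nonneg (erfc_nonneg _) two_pos.le
  obtain ⟨s1, l1⟩ := tsum_erfc_le (q := q) hp hh
  set V : ℝ := ∑' k : ℕ, v (k + 1) with hV
  have hsV : HasSum (fun k : ℕ => v (k + 1)) V := (s1.div_const 2).hasSum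
  have hVle : h * V ≤ p / 2 * (Real.exp (-q ^ 2) / Real.sqrt Real.pi - q * erfc q) := by
    have : V = (∑' k : ℕ, erfc ((k + 1 : ℕ) * h / p + q)) / 2 := by
      rw [hV, ← tsum_div_const]
    rw [this]
    linarith
  -- Majorant of the error at `|n| = m`: `v m` for replacing the weight, and `v (m - N)` for a
  -- dropped node. At the extra node `n = -N-1`, which is kept, the second term is superfluous but
  -- harmless.
  set E : ℕ → ℝ := fun m => v m + if m ≤ N then 0 else v (m - N) with hE
  have hE0 : HasSum (fun m : ℕ => if m ≤ N then 0 else v (m - N)) V := by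
    rw [← hasSum_nat_add_iff' (N + 1), Finset.sum_eq_zero, sub_zero]
    · refine hsV.congr_fun fun k => ?_
      rw [if_neg (by omega)]
      congr 1
      omega
    · intro i hi
      rw [if_pos (by simpa [Nat.lt_succ_iff] using hi)]
  have hv1 : HasSum v (V + v 0) := by
    rw [← hasSum_nat_add_iff' 1]
    simpa using hsV
  have hE1 : HasSum E (V + v 0 + V) := hv1.add hE0
  have hE2 : HasSum (fun m => E (m + 1)) (V + V) := by
    have h0 : E 0 = v 0 := by simp [hE]
    have h1 := (hasSum_nat_add_iff' 1).2 hE1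
    rwa [Finset.sum_range_one, h0, show V + v 0 + V - v 0 = V + V by ring] at h1
  have hEint : HasSum (fun n : ℤ => E n.natAbs) (V + v 0 + V + (V + V)) := by
    refine HasSum.of_nat_of_neg_add_one (by simpa using hE1) ?_
    refine hE2.congr_fun fun k => ?_
    congr 1
  set g : ℤ → ℂ := fun n =>
    (smoothWeight p q (n * h) : ℂ) * (f (n * h) * exp (-I * ω * (n * h))) with hg
  set b : ℤ → ℂ := fun n =>
    (weight p q |(n : ℝ) * h| : ℂ) * f (n * h) * exp (-I * ω * (n * h)) with hb
  set S := Finset.Icc (-(N : ℤ) - 1) (N : ℤ) with hS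
  have hbS : HasSum (fun n => if n ∈ S then b n else 0) (∑ n ∈ S, b n) := by
    have h1 : HasSum (fun n => if n ∈ S then b n else 0) (∑ n ∈ S, if n ∈ S then b n else 0) :=
      hasSum_sum_of_ne_finset_zero fun n hn => if_neg hn
    rwa [Finset.sum_congr rfl fun n hn => if_pos hn] at h1
  have habs : ∀ n : ℤ, |(n : ℝ) * h| = (n.natAbs : ℝ) * h := fun n => by
    rw [abs_mul, abs_of_pos hh, Nat.cast_natAbs, Int.cast_abs]
  have hfe : ∀ n : ℤ, ‖f (n * h) * exp (-I * ω * (n * h))‖ ≤ M := fun n => by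
    have h1 := hM (n * h)
    have h2 := norm_exp_neg_I_mul_ofReal ω (n * h)
    push_cast at h1 h2
    rw [norm_mul, h2, mul_one]
    exact h1
  have hW : ∀ n : ℤ, smoothWeight p q (n * h) + v n.natAbs = weight p q |(n : ℝ) * h| :=
    fun n => by
      rw [weight_eq, smoothWeight_abs, habs]
  have hbound : ∀ n : ℤ, ‖g n - (if n ∈ S then b n else 0)‖ ≤ M * E n.natAbs := by
    intro n
    by_cases hn : n ∈ S
    · have e : g n - b n = -((v n.natAbs : ℝ) : ℂ) * (f (n * h) * exp (-I * ω * (n * h))) := by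
        simp only [hg, hb]
        rw [← hW]
        push_cast
        ring
      rw [if_pos hn, e, norm_mul, norm_neg, norm_real, Real.norm_of_nonneg (hv0 _), mul_comm]
      refine mul_le_mul (hfe n) ?_ (hv0 _) hM0
      · simp only [hE]
        have := hv0 (n.natAbs - N)
        split_ifs <;> linarith
    · have hnN : N < n.natAbs := by
        simp only [hS, Finset.mem_Icc, not_and_or, not_le] at hn
        omega
      -- `N h = 2pq` turns `|n|h/p - q` into `(|n| - N)h/p + q`.
      have e : weight p q |(n : ℝ) * h| = v (n.natAbs - N) := by
        simp only [weight, hv, habs]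
        rw [Nat.cast_sub hnN.le]
        have : (n.natAbs : ℝ) * h / p - q = (n.natAbs - N) * h / p + q := by
          field_simp
          linear_combination hN
        rw [this]
        ring
      rw [if_neg hn, sub_zero, norm_mul, norm_real,
        Real.norm_of_nonneg (smoothWeight_nonneg hq _), mul_comm]
      gcongr
      · exact smoothWeight_nonneg hq _
      · exact hfe n
      · have := hv0 n.natAbs
        simp only [hE, if_neg (not_le.2 hnN)]
        linarith [e ▸ hW n]
  have htr : trapezoidalSum f p q h N ω = h * ∑ n ∈ S, b n := rfl
  rw [htr, ← mul_sub, norm_mul, norm_real, Real.norm_of_nonneg hh.le,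
    ← (hsum.hasSum.sub hbS).tsum_eq]
  have hle := tsum_of_norm_bounded (hEint.mul_left M) hbound
  have hv0' : v 0 = erfc q / 2 := by simp [hv]
  calc _ ≤ h * (M * (V + v 0 + V + (V + V))) := by gcongr
    _ = M * (4 * (h * V) + h / 2 * erfc q) := by rw [hv0']; ring
    _ ≤ M * (4 * (p / 2 * (Real.exp (-q ^ 2) / Real.sqrt Real.pi - q * erfc q)) +
        h / 2 * erfc q) := by gcongr
    _ = _ := by ring

/-- With `x = e^{-u}` and `y = e^{-E} ≤ x`, the factor `x⁻¹ + x` cancels `1 + x²` in `1 - x⁴ = (1 -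
x²)(1 + x²)`. The square root from Cauchy-Schwarz matters here: a plain geometric series `y²/(1 -
y²)` would leave an additional `1 + x²`. -/
theorem exp_add_exp_neg_mul_sqrt_le {a u E : ℝ} (hau : |a| ≤ u) (hu : 0 < u) (huE : u ≤ E) :
    (Real.exp a + Real.exp (-a)) *
      Real.sqrt (Real.exp (-(2 * E)) ^ 2 / (1 - Real.exp (-(2 * E)) ^ 2)) ≤
      Real.exp (-E) / (1 - Real.exp (-2 * u)) := by
  have hcosh : Real.exp a + Real.exp (-a) ≤ Real.exp u + Real.exp (-u) := by
    have := Real.cosh_le_cosh.2 (hau.trans (le_abs_self u))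
    rw [Real.cosh_eq, Real.cosh_eq] at this
    linarith
  set x := Real.exp (-u) with hx
  set y := Real.exp (-E) with hy
  have hx0 : 0 < x := Real.exp_pos _
  have hy0 : 0 < y := Real.exp_pos _
  have hx1 : x < 1 := Real.exp_lt_one_iff.2 (by linarith)
  have hyx : y ≤ x := Real.exp_le_exp.2 (by linarith)
  have e1 : Real.exp u = x⁻¹ := by rw [hx, Real.exp_neg, inv_inv]
  have e2 : Real.exp (-(2 * E)) = y ^ 2 := by rw [hy, ← Real.exp_nat_mul]; congr 1; push_cast; ring
  have e3 : Real.exp (-2 * u) = x ^ 2 := by rw [hx, ← Real.exp_nat_mul]; congr 1; push_cast; ring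
  rw [e2, e3]
  refine (mul_le_mul_of_nonneg_right hcosh (Real.sqrt_nonneg _)).trans ?_
  rw [e1]
  have hx2 : x ^ 2 < 1 := by nlinarith
  have hy2 : y ^ 2 ≤ x ^ 2 := by gcongr
  have hx4 : 0 < 1 - x ^ 4 := by nlinarith [sq_nonneg x]
  have hy4 : 0 < 1 - y ^ 4 := by nlinarith [sq_nonneg y]
  have key : Real.sqrt ((y ^ 2) ^ 2 / (1 - (y ^ 2) ^ 2)) ≤ y * x / (1 - x ^ 4) := by
    apply Real.sqrt_le_iff.2
    refine ⟨by positivity, ?_⟩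
    rw [div_pow, div_le_div_iff₀ (by nlinarith) (by positivity)]
    have h1 : y ^ 2 * (1 - x ^ 4) ≤ x ^ 2 * (1 - y ^ 4) := by
      have : 0 ≤ (x ^ 2 - y ^ 2) * (1 + x ^ 2 * y ^ 2) :=
        mul_nonneg (by linarith) (by positivity)
      nlinarith
    have h2 : (1 - x ^ 4) ≤ 1 := by linarith [pow_pos hx0 4]
    calc (y ^ 2) ^ 2 * (1 - x ^ 4) ^ 2 = y ^ 2 * (y ^ 2 * (1 - x ^ 4)) * (1 - x ^ 4) := by ring
      _ ≤ y ^ 2 * (x ^ 2 * (1 - y ^ 4)) * 1 := by gcongr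
      _ = _ := by ring
  calc _ ≤ (x⁻¹ + x) * (y * x / (1 - x ^ 4)) := by gcongr
    _ = y / (1 - x ^ 2) := by
      have h1 : 1 - x ^ 2 ≠ 0 := by linarith
      have h2 : 1 - x ^ 4 ≠ 0 := hx4.ne'
      field_simp
      ring

theorem integral_erfc_abs_le {f : ℂ → ℂ} {M p q ω : ℝ} (hp : 0 < p)
    (hM : ∀ x : ℝ, ‖f x‖ ≤ M) (hf : Continuous fun x : ℝ => f x) :
    Integrable (fun x : ℝ => ((erfc (|x| / p + q) / 2 : ℝ) : ℂ) * (f x * exp (-I * ω * x))) ∧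
      ‖∫ x : ℝ, ((erfc (|x| / p + q) / 2 : ℝ) : ℂ) * (f x * exp (-I * ω * x))‖ ≤
        M * (p * (Real.exp (-q ^ 2) / Real.sqrt Real.pi - q * erfc q)) := by
  have hi : Integrable fun x : ℝ => M * (erfc (|x| / p + q) / 2) :=
    ((integrable_comp_abs (integrableOn_erfc_div_add hp q)).div_const 2).const_mul M
  have hb : ∀ x : ℝ, ‖((erfc (|x| / p + q) / 2 : ℝ) : ℂ) * (f x * exp (-I * ω * x))‖ ≤
      M * (erfc (|x| / p + q) / 2) := fun x => by
    rw [norm_mul, norm_mul, norm_exp_neg_I_mul_ofReal, mul_one, norm_real,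
      Real.norm_of_nonneg (div_nonneg (erfc_nonneg _) two_pos.le), mul_comm]
    exact mul_le_mul_of_nonneg_right (hM x) (div_nonneg (erfc_nonneg _) two_pos.le)
  have hc : Continuous fun x : ℝ =>
      ((erfc (|x| / p + q) / 2 : ℝ) : ℂ) * (f x * exp (-I * ω * x)) := by
    have h1 : Continuous fun x : ℝ => erfc (|x| / p + q) / 2 := by
      have := continuous_erfc
      fun_prop
    exact (continuous_ofReal.comp h1).mul (hf.mul (by fun_prop))
  refine ⟨hi.mono' hc.aestronglyMeasurable (ae_of_all _ hb), ?_⟩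
  refine (norm_integral_le_of_norm_le hi (ae_of_all _ hb)).trans (le_of_eq ?_)
  rw [integral_const_mul, integral_div, integral_comp_abs (f := fun x => erfc (x / p + q)),
    integral_Ioi_erfc_div_add hp]
  ring

/-! ### Assembly of the error and its constants. -/

theorem smoothWeight_trapezoid {f : ℂ → ℂ} {d M p q h ω : ℝ} (hd : 0 < d) (hh : 0 < h)
    (hp : 0 < p) (hq : 0 ≤ q) (han : AnalyticOnNhd ℂ f (strip d))
    (hbd : ∀ z ∈ strip d, ‖f z‖ ≤ M) :
    (Summable fun n : ℤ =>
        (smoothWeight p q (n * h) : ℂ) * (f (n * h) * exp (-I * ω * (n * h)))) ∧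
      ‖h * ∑' n : ℤ, (smoothWeight p q (n * h) : ℂ) * (f (n * h) * exp (-I * ω * (n * h))) -
        ∫ x : ℝ, (smoothWeight p q x : ℂ) * (f x * exp (-I * ω * x))‖ ≤
        M * Real.exp (d ^ 2 / p ^ 2) * (h * (1 - erfc q) + 2 * (p * q)) *
          ((Real.exp (ω * d) + Real.exp (-(ω * d))) *
            Real.sqrt (Real.exp (-(2 * (Real.pi * d / h))) ^ 2 /
              (1 - Real.exp (-(2 * (Real.pi * d / h))) ^ 2))) := by
  have hM0 : 0 ≤ M := (norm_nonneg _).trans (hbd 0 (by simpa [strip] using hd))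
  have key := norm_trapezoid_sub_integral_le
    (g := fun z => csmoothWeight p q z * (f z * exp (-I * ω * z))) (φ := smoothWeight p q)
    (a := ω) (A := M * Real.exp (d ^ 2 / p ^ 2)) hd hh (by positivity)
    ((differentiable_csmoothWeight p q).differentiableOn.mul
      (han.differentiableOn.mul (by fun_prop)))
    (fun z hz => by
      have h1 := norm_csmoothWeight_le p hq z
      have h2 : Real.exp (z.im ^ 2 / p ^ 2) ≤ Real.exp (d ^ 2 / p ^ 2) := by
        apply Real.exp_le_exp.2
        have him : |z.im| < d := hz
        have : z.im ^ 2 ≤ d ^ 2 := sq_le_sq' (abs_lt.1 him).1.le (abs_lt.1 him).2.le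
        gcongr
      have h3 := hbd z hz
      have h4 := smoothWeight_nonneg (p := p) hq z.re
      rw [norm_mul, norm_mul, norm_exp_neg_I_mul]
      calc _ ≤ Real.exp (d ^ 2 / p ^ 2) * smoothWeight p q z.re *
            (M * Real.exp (ω * z.im)) := by
            gcongr
            exact h1.trans (by gcongr)
        _ = _ := by ring)
    (smoothWeight_antitoneOn hp hq) (smoothWeight_nonneg hq) (integrableOn_smoothWeight hp q)
    (smoothWeight_neg p q)
  have e : ∀ n : ℤ, csmoothWeight p q (n * h) = smoothWeight p q (n * h) := fun n => by
    rw [← csmoothWeight_ofReal]; push_cast; rfl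
  simp only [e, csmoothWeight_ofReal, smoothWeight_zero, integral_Ioi_smoothWeight hp] at key
  refine ⟨key.1, key.2.trans (le_of_eq ?_)⟩
  rw [mul_assoc, show 2 * Real.pi * d / h = 2 * (Real.pi * d / h) by ring]

/-- The three terms are the rotated integrals, the discretization of `W`, and the tail. The factor
`3p` is `2p` from the sum plus `p` from the integral of `erfc(|x|/p + q)/2`. -/
theorem exists_fourierTransform {f : ℂ → ℂ} {α d M β p q h ω ωd : ℝ} {N : ℕ} (hd : 0 < d)
    (hs : SectorAssumption f α M) (han : AnalyticOnNhd ℂ f (strip d))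
    (hbd : ∀ z ∈ strip d, ‖f z‖ ≤ M)
    (hβ : 0 < β) (hβ1 : β < 1) (hβα : β ≤ α) (hp : 0 < p) (hq : 0 ≤ q) (hh : 0 < h)
    (hωd : 0 < ωd) (hω : ωd ≤ |ω|) (hpq : ωd * p = 2 * q) (hN : N * h = 2 * p * q) :
    ∃ F : ℂ, HasFourierTransformAt f ω F ∧ ‖F - trapezoidalSum f p q h N ω‖ ≤
      2 * halfLineBound M p q ωd β +
        M * Real.exp (d ^ 2 / p ^ 2) * (h * (1 - erfc q) + 2 * (p * q)) *
          ((Real.exp (ω * d) + Real.exp (-(ω * d))) *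
            Real.sqrt (Real.exp (-(2 * (Real.pi * d / h))) ^ 2 /
              (1 - Real.exp (-(2 * (Real.pi * d / h))) ^ 2))) +
        M * (3 * p * (Real.exp (-q ^ 2) / Real.sqrt Real.pi - q * erfc q) + h / 2 * erfc q) := by
  obtain ⟨L, hL, hLb⟩ :=
    tendsto_integral_one_sub_weight hd hs han hbd hβ hβ1 hβα hp hωd hω hpq
  have hfc := continuous_ofReal_of_strip hd han
  have hM : ∀ x : ℝ, ‖f x‖ ≤ M := fun x => hbd x (by simpa [strip] using hd)
  obtain ⟨vi, vb⟩ := integral_erfc_abs_le (q := q) (ω := ω) hp hM hfc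
  obtain ⟨ss, sb⟩ := smoothWeight_trapezoid (ω := ω) hd hh hp hq han hbd
  have tb := norm_trapezoidalSum_sub_le (ω := ω) hp hh hq hM hN ss
  have Wi : Integrable fun x : ℝ => (smoothWeight p q x : ℂ) * (f x * exp (-I * ω * x)) := by
    have h1 : Integrable fun x : ℝ => M * smoothWeight p q |x| :=
      (integrable_comp_abs (integrableOn_smoothWeight hp q)).const_mul M
    refine h1.mono' ?_ (ae_of_all _ fun x => ?_)
    · exact ((continuous_ofReal.comp (continuous_smoothWeight p q)).mul
        (hfc.mul (by fun_prop))).aestronglyMeasurable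
    · rw [norm_mul, norm_mul, norm_exp_neg_I_mul_ofReal, mul_one, norm_real, smoothWeight_abs,
        Real.norm_of_nonneg (smoothWeight_nonneg hq _), mul_comm]
      exact mul_le_mul_of_nonneg_right (hM x) (smoothWeight_nonneg hq _)
  have hw : ∀ x : ℝ, ((weight p q |x| : ℝ) : ℂ) * (f x * exp (-I * ω * x)) =
      (smoothWeight p q x : ℂ) * (f x * exp (-I * ω * x)) +
        ((erfc (|x| / p + q) / 2 : ℝ) : ℂ) * (f x * exp (-I * ω * x)) := fun x => by
    rw [weight_eq, smoothWeight_abs]; push_cast; ring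
  have wi : Integrable fun x : ℝ => ((weight p q |x| : ℝ) : ℂ) * (f x * exp (-I * ω * x)) := by
    simp only [hw]; exact Wi.add vi
  have hwl : Tendsto (fun R : ℝ × ℝ => ∫ x in R.1..R.2,
      ((weight p q |x| : ℝ) : ℂ) * (f x * exp (-I * ω * x))) (atBot ×ˢ atTop)
      (𝓝 (∫ x : ℝ, ((weight p q |x| : ℝ) : ℂ) * (f x * exp (-I * ω * x)))) :=
    intervalIntegral_tendsto_integral wi tendsto_fst tendsto_snd
  refine ⟨L + ∫ x : ℝ, ((weight p q |x| : ℝ) : ℂ) * (f x * exp (-I * ω * x)), ?_, ?_⟩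
  · refine (hL.add hwl).congr fun R => ?_
    rw [← intervalIntegral.integral_add]
    · refine intervalIntegral.integral_congr fun x _ => ?_
      push_cast; ring
    · refine Continuous.intervalIntegrable ?_ _ _
      exact (continuous_ofReal.comp (continuous_const.sub
        ((continuous_weight p q).comp continuous_abs))).mul (hfc.mul (by fun_prop))
    · exact wi.intervalIntegrable
  · simp only [hw]
    rw [integral_add Wi vi]
    generalize (∫ x : ℝ, (smoothWeight p q x : ℂ) * (f x * exp (-I * ω * x))) = A at *
    generalize (∫ x : ℝ, ((erfc (|x| / p + q) / 2 : ℝ) : ℂ) * (f x * exp (-I * ω * x))) = V at *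
    generalize ∑' n : ℤ, (smoothWeight p q (n * h) : ℂ) * (f (n * h) * exp (-I * ω * (n * h))) = S
      at *
    have e : L + (A + V) - trapezoidalSum f p q h N ω =
        L + V - (h * S - A) + (h * S - trapezoidalSum f p q h N ω) := by ring
    rw [e]
    refine (norm_add_le _ _).trans ?_
    have n1 := norm_sub_le (L + V) (h * S - A)
    have n2 := norm_add_le L V
    nlinarith

theorem two_mul_halfLineBound_le {M p q E ωd ωu : ℝ} (hM : 0 ≤ M) (hp : 0 < p)
    (hωd : 0 < ωd) (hωu : ωd < ωu) (hE : E = 2 * ωd / (ωd + ωu) * q ^ 2) :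
    2 * halfLineBound M p q ωd (ωd / ωu) ≤
      M * Real.sqrt (ωu ^ 2 + ωd ^ 2) *
        (Real.sqrt Real.pi / Real.sqrt (ωu ^ 2 - ωd ^ 2) * p + 2 / ωd ^ 2) * Real.exp (-E) := by
  have hu : 0 < ωu := hωd.trans hωu
  have hsub : 0 < ωu ^ 2 - ωd ^ 2 := by nlinarith
  have e1 : Real.sqrt (1 + (ωd / ωu) ^ 2) = Real.sqrt (ωu ^ 2 + ωd ^ 2) / ωu := by
    rw [← Real.sqrt_sq hu.le, ← Real.sqrt_div (by positivity), Real.sqrt_sq hu.le]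
    congr 1; field_simp
  have e2 : Real.sqrt (Real.pi / (1 - (ωd / ωu) ^ 2)) =
      Real.sqrt Real.pi * ωu / Real.sqrt (ωu ^ 2 - ωd ^ 2) := by
    have : Real.pi / (1 - (ωd / ωu) ^ 2) = Real.pi * ωu ^ 2 / (ωu ^ 2 - ωd ^ 2) := by
      have h1 : 1 - (ωd / ωu) ^ 2 = (ωu ^ 2 - ωd ^ 2) / ωu ^ 2 := by field_simp
      rw [h1]; field_simp
    rw [this, Real.sqrt_div (by positivity), Real.sqrt_mul (by positivity), Real.sqrt_sq hu.le]
  -- The slope `ωd/ωu` makes the Gaussian exponent exactly `E`; the other exponent `2βq²` is larger.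
  have e3 : 2 * (ωd / ωu) * q ^ 2 / (1 + ωd / ωu) = E := by
    rw [hE]; field_simp; ring
  have e4 : Real.exp (-(2 * (ωd / ωu) * q ^ 2)) ≤ Real.exp (-E) := by
    apply Real.exp_le_exp.2
    rw [neg_le_neg_iff, ← e3]
    apply div_le_self (by positivity)
    have : 0 < ωd / ωu := by positivity
    linarith
  rw [halfLineBound, e1, e2, e3]
  calc _ ≤ 2 * (M * (Real.sqrt (ωu ^ 2 + ωd ^ 2) / ωu) *
        (p / 2 * (Real.sqrt Real.pi * ωu / Real.sqrt (ωu ^ 2 - ωd ^ 2)) * Real.exp (-E) +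
          Real.exp (-E) / (ωd / ωu * ωd))) := by gcongr
    _ = _ := by
      have : Real.sqrt (ωu ^ 2 - ωd ^ 2) ≠ 0 := (Real.sqrt_pos.2 hsub).ne'
      field_simp

theorem discretization_truncation_le {M p q h d E ωd ωu ω : ℝ} {N : ℕ} (hM : 0 ≤ M) (hp : 0 < p)
    (hq : 0 < q) (hh : 0 < h) (hd : 0 < d) (hωd : 0 < ωd) (h2 : 2 * ωd ≤ ωu)
    (hN1 : 1 ≤ N) (hpq : ωd * p = 2 * q) (hN : N * h = 2 * p * q) (hhu : h * ωu ≤ Real.pi)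
    (hdN : 4 * d ≤ N * h) (hE : E = Real.pi * d / h) (hEq : E ≤ q ^ 2) (hω : |ω| ≤ ωu) :
    M * Real.exp (d ^ 2 / p ^ 2) * (h * (1 - erfc q) + 2 * (p * q)) *
          ((Real.exp (ω * d) + Real.exp (-(ω * d))) *
            Real.sqrt (Real.exp (-(2 * E)) ^ 2 / (1 - Real.exp (-(2 * E)) ^ 2))) +
        M * (3 * p * (Real.exp (-q ^ 2) / Real.sqrt Real.pi - q * erfc q) + h / 2 * erfc q) ≤
      (2 * M / (1 - Real.exp (-2 * d * ωu)) * (Real.sqrt Real.pi / 2 * p + p * q) *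
        Real.exp (d * ωd / 4) + Real.sqrt Real.pi * M / 2 * p) * Real.exp (-E) := by
  have hu : 0 < ωu := by linarith
  have hπ := Real.pi_pos
  have hs : 0 < Real.sqrt Real.pi := Real.sqrt_pos.2 hπ
  have hss : Real.sqrt Real.pi ^ 2 = Real.pi := Real.sq_sqrt hπ.le
  have huE : d * ωu ≤ E := by
    rw [hE, le_div_iff₀ hh]
    nlinarith
  have hux : Real.exp (-2 * d * ωu) < 1 := Real.exp_lt_one_iff.2 (by nlinarith [mul_pos hd hu])
  have hk := exp_add_exp_neg_mul_sqrt_le (a := ω * d) (u := d * ωu) (E := E)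
    (by rw [abs_mul, abs_of_pos hd, mul_comm]; gcongr) (by positivity) huE
  rw [show -2 * (d * ωu) = -2 * d * ωu by ring] at hk
  set s := 1 - Real.exp (-2 * d * ωu) with hsdef
  have hs0 : 0 < s := by linarith
  have hs1 : s ≤ 1 := by linarith [Real.exp_pos (-2 * d * ωu)]
  have hdp : d ^ 2 / p ^ 2 ≤ d * ωd / 4 := by
    have : N * h = ωd * p ^ 2 := by rw [hN]; linear_combination -p * hpq
    rw [div_le_div_iff₀ (by positivity) (by norm_num)]
    nlinarith [mul_le_mul_of_nonneg_left hdN hd.le]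
  have hexp : Real.exp (d ^ 2 / p ^ 2) ≤ Real.exp (d * ωd / 4) := Real.exp_le_exp.2 hdp
  have hexp1 : 1 ≤ Real.exp (d * ωd / 4) := Real.one_le_exp (by positivity)
  -- Here `ωd/ωu ≤ 1/2` enters: `2 ωd h ≤ ωu h ≤ π`.
  have hW : h * (1 - erfc q) ≤ Real.sqrt Real.pi / 2 * p := by
    calc h * (1 - erfc q) ≤ h * (2 * q / Real.sqrt Real.pi) := by
          gcongr; exact one_sub_erfc_le hq.le
      _ ≤ _ := by
          rw [mul_div_assoc', div_le_iff₀ hs]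
          have : h * (2 * ωd) ≤ Real.pi := (by gcongr : h * (2 * ωd) ≤ h * ωu).trans hhu
          nlinarith [mul_le_mul_of_nonneg_left this hp.le]
  -- The `erfc q` terms combine to a nonpositive one since `h ≤ N h = 2pq`, and `3/√π ≤ √π`.
  have hT : 3 * p * (Real.exp (-q ^ 2) / Real.sqrt Real.pi - q * erfc q) + h / 2 * erfc q ≤
      Real.sqrt Real.pi * p * Real.exp (-E) := by
    have h1 : h / 2 ≤ 3 * p * q := by
      have : (1 : ℝ) ≤ N := by exact_mod_cast hN1
      nlinarith [mul_le_mul_of_nonneg_right this hh.le, mul_pos hp hq]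
    have h3 : 3 * (Real.exp (-q ^ 2) / Real.sqrt Real.pi) ≤
        Real.sqrt Real.pi * Real.exp (-q ^ 2) := by
      rw [mul_div_assoc', div_le_iff₀ hs]
      nlinarith [Real.pi_gt_three, Real.exp_pos (-q ^ 2)]
    have h4 : Real.exp (-q ^ 2) ≤ Real.exp (-E) := Real.exp_le_exp.2 (by linarith)
    calc _ ≤ p * (3 * (Real.exp (-q ^ 2) / Real.sqrt Real.pi)) := by
          nlinarith [mul_le_mul_of_nonneg_right h1 (erfc_nonneg q)]
      _ ≤ p * (Real.sqrt Real.pi * Real.exp (-E)) := by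
          exact mul_le_mul_of_nonneg_left (h3.trans (by gcongr)) hp.le
      _ = _ := by ring
  have hD : 0 ≤ 1 - erfc q := by
    rw [← smoothWeight_zero 1 q]; exact smoothWeight_nonneg hq.le 0
  have hE0 := Real.exp_pos (-E)
  have step1 : M * Real.exp (d ^ 2 / p ^ 2) * (h * (1 - erfc q) + 2 * (p * q)) *
      ((Real.exp (ω * d) + Real.exp (-(ω * d))) *
        Real.sqrt (Real.exp (-(2 * E)) ^ 2 / (1 - Real.exp (-(2 * E)) ^ 2))) ≤
      M * Real.exp (d * ωd / 4) * (Real.sqrt Real.pi / 2 * p + 2 * (p * q)) *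
        (Real.exp (-E) / s) := by gcongr
  -- The tail `√π p M e^{-E}` is paid half by `C₃` and half by the slack in `C₂`, whose `p` term is
  -- twice what the discretization needs.
  have step2 : Real.sqrt Real.pi / 2 * p * M * Real.exp (-E) ≤
      Real.sqrt Real.pi / 2 * p * M * Real.exp (-E) * (Real.exp (d * ωd / 4) / s) := by
    apply le_mul_of_one_le_right (by positivity)
    rw [one_le_div hs0]; linarith
  have step3 := mul_le_mul_of_nonneg_left hT hM
  calc _ ≤ M * Real.exp (d * ωd / 4) * (Real.sqrt Real.pi / 2 * p + 2 * (p * q)) *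
        (Real.exp (-E) / s) + M * (Real.sqrt Real.pi * p * Real.exp (-E)) :=
        add_le_add step1 step3
    _ ≤ M * Real.exp (d * ωd / 4) * (Real.sqrt Real.pi / 2 * p + 2 * (p * q)) *
        (Real.exp (-E) / s) + (Real.sqrt Real.pi / 2 * p * M * Real.exp (-E) *
          (Real.exp (d * ωd / 4) / s) + Real.sqrt Real.pi / 2 * p * M * Real.exp (-E)) := by
        linarith
    _ = _ := by ring

end EulerFT

end

theorem theorem1 (f : ℂ → ℂ) (α d M : ℝ) (hα0 : 0 < α) (hα1 : α < 1) (hd : 0 < d)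
    (hsector : EulerFT.SectorAssumption f α M) (hstrip : EulerFT.StripAssumption f d M)
    (ωd ωu : ℝ) (hωd : 0 < ωd) (hωu : ωd < ωu) (hratio : ωd / ωu ≤ min α (1 / 2))
    (N : ℕ) (hN : 2 * d * (ωd + ωu) * ωu ^ 2 / (Real.pi * ωd ^ 2) ≤ (N : ℝ))
    (h p q : ℝ)
    (hh : h = Real.sqrt (2 * Real.pi * d * (ωd + ωu) / (ωd ^ 2 * N)))
    (hp : p = Real.sqrt (N * h / ωd))
    (hq : q = Real.sqrt (ωd * N * h / 4)) :
    ∀ ω : ℝ, ωd ≤ |ω| → |ω| ≤ ωu →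
      ∃ F : ℂ, EulerFT.HasFourierTransformAt f ω F ∧
        ‖F - EulerFT.trapezoidalSum f p q h N ω‖ ≤
          (EulerFT.const₁ d ωd ωu M N + EulerFT.const₂ d ωd ωu M N
              + EulerFT.const₃ d ωd ωu M N) *
            Real.exp (-Real.sqrt (Real.pi * d * ωd ^ 2 * N / (2 * (ωd + ωu)))) := by
  intro ω hω1 hω2
  have hπ := Real.pi_pos
  have hu : 0 < ωu := hωd.trans hωu
  have hβα : ωd / ωu ≤ α := hratio.trans (min_le_left _ _)
  have h2 : 2 * ωd ≤ ωu := by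
    have := hratio.trans (min_le_right _ _)
    rw [div_le_div_iff₀ hu two_pos] at this
    linarith
  have hN0 : (0 : ℝ) < N := lt_of_lt_of_le (by positivity) hN
  have hN1 : 1 ≤ N := by exact_mod_cast Nat.pos_of_ne_zero fun h0 => by simp [h0] at hN0
  have hh0 : 0 < h := by rw [hh]; positivity
  have hhsq : h ^ 2 * (ωd ^ 2 * N) = 2 * Real.pi * d * (ωd + ωu) := by
    rw [hh, Real.sq_sqrt (by positivity)]; field_simp
  have hp0 : 0 < p := by rw [hp]; positivity
  have hq0 : 0 < q := by rw [hq]; positivity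
  have hpsq : p ^ 2 * ωd = N * h := by
    rw [hp, Real.sq_sqrt (by positivity)]; field_simp
  have hqsq : 4 * q ^ 2 = ωd * N * h := by
    rw [hq, Real.sq_sqrt (by positivity)]; field_simp
  have hpq : ωd * p = 2 * q := by
    rw [← sq_eq_sq₀ (by positivity) (by positivity)]
    linear_combination ωd * hpsq - hqsq
  have hNh : N * h = 2 * p * q := by linear_combination p * hpq - hpsq
  -- This is the lower bound on `N` rewritten through the definition of `h`.
  have hhu : h * ωu ≤ Real.pi := by
    rw [← sq_le_sq₀ (by positivity) (by positivity)]
    rw [div_le_iff₀ (by positivity)] at hN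
    have h3 : (h * ωu) ^ 2 * (ωd ^ 2 * N) ≤ Real.pi ^ 2 * (ωd ^ 2 * N) := by
      calc _ = Real.pi * (2 * d * (ωd + ωu) * ωu ^ 2) := by linear_combination ωu ^ 2 * hhsq
        _ ≤ Real.pi * (N * (Real.pi * ωd ^ 2)) := by gcongr
        _ = _ := by ring
    exact le_of_mul_le_mul_right h3 (by positivity)
  have hE : Real.sqrt (Real.pi * d * ωd ^ 2 * N / (2 * (ωd + ωu))) = Real.pi * d / h := by
    rw [Real.sqrt_eq_iff_mul_self_eq (by positivity) (by positivity)]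
    field_simp
    linear_combination hhsq
  -- The balance that determines `h`: discretization and rotation errors have the same exponent.
  have hEq : Real.pi * d / h = 2 * ωd / (ωd + ωu) * q ^ 2 := by
    field_simp
    linear_combination (-ωd * h / 2) * hqsq - hhsq / 2
  have hEq2 : Real.pi * d / h ≤ q ^ 2 := by
    rw [hEq]
    apply mul_le_of_le_one_left (by positivity)
    rw [div_le_one (by positivity)]
    linarith
  have hdN : 4 * d ≤ N * h := by
    have h3 : 4 * d * (h * ωd ^ 2) ≤ N * h * (h * ωd ^ 2) := by
      have h4 : h * (2 * ωd) ≤ Real.pi := (by gcongr : h * (2 * ωd) ≤ h * ωu).trans hhu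
      calc 4 * d * (h * ωd ^ 2) = 2 * d * ωd * (h * (2 * ωd)) := by ring
        _ ≤ 2 * d * (ωd + ωu) * Real.pi := by gcongr; linarith
        _ = _ := by linear_combination -hhsq
    exact le_of_mul_le_mul_right h3 (by positivity)
  -- The fourth root in the constants is `p`, and the square root in `C₂` is `pq`.
  have hX : (2 * Real.pi * d * (ωd + ωu) * N / ωd ^ 4) ^ (1 / 4 : ℝ) = p := by
    have h3 : 2 * Real.pi * d * (ωd + ωu) * N / ωd ^ 4 = p ^ 4 := by
      rw [div_eq_iff (by positivity)]
      linear_combination (-(N : ℝ)) * hhsq - (p ^ 2 * ωd + N * h) * ωd ^ 2 * hpsq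
    rw [h3, ← Real.rpow_natCast, ← Real.rpow_mul hp0.le]
    norm_num
  have hY : Real.sqrt (Real.pi * d * (ωd + ωu) * N / (2 * ωd ^ 2)) = p * q := by
    rw [Real.sqrt_eq_iff_mul_self_eq (by positivity) (by positivity)]
    field_simp
    have h3 : (2 * p * q) ^ 2 * ωd ^ 2 = 2 * Real.pi * d * (ωd + ωu) * N := by
      rw [← hNh]; linear_combination (N : ℝ) * hhsq
    linear_combination -h3 / 2
  have hM0 : 0 ≤ M :=
    (norm_nonneg _).trans (hstrip.bound 0 (by simpa [EulerFT.strip] using hd))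
  obtain ⟨F, hF, hFb⟩ := EulerFT.exists_fourierTransform hd hsector hstrip.analytic hstrip.bound
    (div_pos hωd hu) ((div_lt_one hu).2 hωu) hβα hp0 hq0.le hh0 hωd hω1 hpq hNh
  refine ⟨F, hF, hFb.trans ?_⟩
  have b1 := EulerFT.two_mul_halfLineBound_le hM0 hp0 hωd hωu hEq
  have b2 := EulerFT.discretization_truncation_le hM0 hp0 hq0 hh0 hd hωd h2 hN1 hpq hNh hhu hdN
    rfl hEq2 hω2
  rw [hE, EulerFT.const₁, EulerFT.const₂, EulerFT.const₃, hX, hY]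
  linarith
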